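/- **Setting.** Let $H,K,U$ be separable real Hilbert spaces and $T>0$. Write $\Sigma(\cdot)$ (resp. $\Sigma^+(\cdot)$) for the bounded self-adjoint (resp. self-adjoint nonnegative) operators, and $C_s([0,T];\Sigma^+(H))$ for the strongly continuous maps $[0,T]\to\Sigma^+(H)$. Let $A:D(A)\subset H\to H$ be a closed densely defined operator generating a $C_0$-semigroup $(e^{tA})_{t\ge 0}$, with $e^{tA^*}=(e^{tA})^*$; let $B\in\mathcal L(U;H)$, $\sigma\in\mathcal L(K;H)$, $S,S_T\in\mathcal L(H)$, $Q,Q_T\in\Sigma^+(H)$, $\overline Q,\overline Q_T\in\Sigma(H)$ with $Q+\overline Q,\ Q_T+\overline Q_T\in\Sigma^+(H)$, and $R\in\Sigma(U)$ with $\langle R\alpha,\alpha\rangle\ge\varepsilon|\alpha|^2$ for all $\alpha\in U$ and some $\varepsilon>0$. Let $m_0$ be a Borel probability measure on $H$ with finite first moment and $z_0=\int_H x\,m_0(dx)$. A map $P\in C_s([0,T];\Sigma^+(H))$ is a *mild solution of the Riccati equation* if for all $x\in H$, $t\in[0,T]$ $$P(t)x=e^{(T-t)A^*}(Q_T+\overline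 Q_T)e^{(T-t)A}x+\int_t^T e^{(s-t)A^*}(Q+\overline Q)e^{(s-t)A}x\,ds-\int_t^T e^{(s-t)A^*}P(s)BR^{-1}B^*P(s)e^{(s-t)A}x\,ds.$$ A *Linear-Quadratic-Mean (LQM) mild solution* of the mean field game is a quadruple $(P,r,z,s)$ with $P\in C_s([0,T];\Sigma^+(H))$, $r,z\in C([0,T];H)$, $s\in C([0,T];\mathbb R)$ such that $P$ is a mild solution of the Riccati equation and, for all $t\in[0,T]$, $$z(t)=e^{tA}z_0-\int_0^t e^{(t-s)A}BR^{-1}B^*P(s)z(s)\,ds-\int_0^t e^{(t-s)A}BR^{-1}B^*r(s)\,ds,$$ $$r(t)=-e^{(T-t)A^*}\overline Q_TS_Tz(T)-\int_t^T e^{(s-t)A^*}P(s)BR^{-1}B^*r(s)\,ds-\int_t^T e^{(s-t)A^*}\overline QSz(s)\,ds,$$ $$s(t)=\tfrac12\langle\overline Q_TS_Tz(T),S_Tz(T)\rangle+\int_t^T\Big[\tfrac12\mathrm{Tr}[\sigma\sigma^*P(u)]-\tfrac12\langle BR^{-1}B^*r(u),r(u)\rangle+\tfrac12\langle\overline QSz(u),Sz(u)\rangle\Big]du,$$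 where the last formula includes that $\sigma\sigma^*P(u)$ is trace class for a.e. $u\in[0,T]$ and $u\mapsto\mathrm{Tr}[\sigma\sigma^*P(u)]$ is integrable on $[0,T]$. **Theorem (Existence).** For all large $n\in\mathbb N$ let $A_n=n^2(n-A)^{-1}-nI\in\mathcal L(H)$ be the Yosida approximations of $A$. Assume that the mild solution $P$ of the Riccati equation has the following properties. * (H1) For all sufficiently large $n$ there is $\eta_n:[0,T]\to\Sigma(H)$ with $\eta_n(T)=-\overline Q_TS_T$ such that, for all $x\in H$, $t\mapsto\eta_n(t)x$ is differentiable on $[0,T]$ and, for all $t\in[0,T]$, $$\tfrac{d}{dt}\eta_n(t)x=(P(t)BR^{-1}B^*-A_n^*)\eta_n(t)x-\eta_n(t)(A_n-BR^{-1}B^*P(t))x+\overline QSx+\eta_n(t)BR^{-1}B^*\eta_n(t)x.$$ * (H2) These $\eta_n$ are bounded uniformly: $\sup_{n,\,t\in[0,T]}\|\eta_n(t)\|_{\mathcal L(H)}<\infty$, the supremum being over those large $n$. * (Trace) $\sigma\sigma^*P(t)$ is trace class for a.e. $t\in[0,T]$ and $t\mapsto\mathrm{Tr}[\sigma\sigma^*P(t)]$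 is integrable on $[0,T]$ (for instance, $\sigma$ is Hilbert–Schmidt). Then there exists an LQM mild solution $(P,r,z,s)$ of the mean field game. (The existence of the mild solution $P$ of the Riccati equation is part of the claim.) -/

import Mathlib

open Set Filter Topology MeasureTheory

namespace LQMFG

section General

variable {H : Type*} [NormedAddCommGroup H] [InnerProductSpace ℝ H]

/-- `E` is a `C₀`-semigroup of bounded operators (only its values on `[0, ∞)` matter). -/
structure IsC0Semigroup (E : ℝ → H →L[ℝ] H) : Prop where
  zero : E 0 = ContinuousLinearMap.id ℝ H
  add : ∀ s t : ℝ, 0 ≤ s → 0 ≤ t → E (s + t) = (E s).comp (E t)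
  tendsto_zero : ∀ x : H, Tendsto (fun t => E t x) (𝓝[>] 0) (𝓝 x)

/-- `A` (with its domain) is the infinitesimal generator of `E`. -/
def IsGenerator (A : H →ₗ.[ℝ] H) (E : ℝ → H →L[ℝ] H) : Prop :=
  ∀ x y : H, (x, y) ∈ A.graph ↔ Tendsto (fun h : ℝ => h⁻¹ • (E h x - x)) (𝓝[>] 0) (𝓝 y)

/-- `J` is a bounded two-sided inverse of `l - A : D(A) → H`. -/
def IsResolvent (A : H →ₗ.[ℝ] H) (l : ℝ) (J : H →L[ℝ] H) : Prop :=
  (∀ y : H, ∃ x : A.domain, (x : H) = J y ∧ l • (x : H) - A x = y) ∧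
    ∀ x : A.domain, J (l • (x : H) - A x) = x

open Classical in
/-- The resolvent operator `R(l, A) = (l - A)⁻¹`; by convention `0` if `l` is not in the
resolvent set. -/
noncomputable def resolventOp (A : H →ₗ.[ℝ] H) (l : ℝ) : H →L[ℝ] H :=
  if h : ∃ J : H →L[ℝ] H, IsResolvent A l J then h.choose else 0

/-- The Yosida approximation `A_n = n² R(n, A) - n I`. -/
noncomputable def yosida (A : H →ₗ.[ℝ] H) (n : ℕ) : H →L[ℝ] H :=
  ((n : ℝ) ^ 2) • resolventOp A (n : ℝ) - (n : ℝ) • ContinuousLinearMap.id ℝ H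

/-- `F` belongs to `C_s([0,T]; Σ⁺(H))`. -/
structure IsStronglyContPos (T : ℝ) (F : ℝ → H →L[ℝ] H) : Prop where
  isPositive : ∀ t ∈ Icc 0 T, (F t).IsPositive
  continuousOn : ∀ x : H, ContinuousOn (fun t => F t x) (Icc 0 T)

/-- Hilbert–Schmidt operators. -/
def IsHilbertSchmidt (L : H →L[ℝ] H) : Prop :=
  ∀ (w : Set H) (b : HilbertBasis w ℝ H), Summable fun i => ‖L (b i)‖ ^ 2

/-- Trace class operators: products of two Hilbert–Schmidt operators. -/
def IsTraceClass (L : H →L[ℝ] H) : Prop :=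
  ∃ L₁ L₂ : H →L[ℝ] H, IsHilbertSchmidt L₁ ∧ IsHilbertSchmidt L₂ ∧ L = L₁.comp L₂

/-- The trace `∑ₖ ⟨eₖ, L eₖ⟩` in an orthonormal basis of `H` (for trace class `L` the value does
not depend on the basis). -/
noncomputable def operatorTrace [CompleteSpace H] (L : H →L[ℝ] H) : ℝ :=
  ∑' i : (exists_hilbertBasis ℝ H).choose,
    inner ℝ ((exists_hilbertBasis ℝ H).choose_spec.choose i)
      (L ((exists_hilbertBasis ℝ H).choose_spec.choose i))

end General

section Game

variable (H K U : Type*)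
  [NormedAddCommGroup H] [InnerProductSpace ℝ H] [CompleteSpace H]
  [NormedAddCommGroup K] [InnerProductSpace ℝ K] [CompleteSpace K]
  [NormedAddCommGroup U] [InnerProductSpace ℝ U] [CompleteSpace U]

/-- The coefficients of the linear-quadratic mean field game; `expA t` stands for `e^{tA}`. -/
structure Coefficients where
  A : H →ₗ.[ℝ] H
  expA : ℝ → H →L[ℝ] H
  B : U →L[ℝ] H
  Q : H →L[ℝ] H
  QT : H →L[ℝ] H
  Qbar : H →L[ℝ] H
  QbarT : H →L[ℝ] H
  R : U →L[ℝ] U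
  S : H →L[ℝ] H
  ST : H →L[ℝ] H
  σ : K →L[ℝ] H

variable {H K U}

namespace Coefficients

/-- The standing assumptions on the coefficients. -/
structure Standing (D : Coefficients H K U) : Prop where
  dense_domain : Dense (D.A.domain : Set H)
  closed : D.A.IsClosed
  semigroup : IsC0Semigroup D.expA
  generator : IsGenerator D.A D.expA
  Q_pos : D.Q.IsPositive
  QT_pos : D.QT.IsPositive
  Qbar_selfAdjoint : IsSelfAdjoint D.Qbar
  QbarT_selfAdjoint : IsSelfAdjoint D.QbarT
  Q_add_Qbar_pos : (D.Q + D.Qbar).IsPositive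
  QT_add_QbarT_pos : (D.QT + D.QbarT).IsPositive
  R_selfAdjoint : IsSelfAdjoint D.R
  R_coercive : ∃ ε > 0, ∀ α : U, ε * ‖α‖ ^ 2 ≤ inner ℝ (D.R α) α

/-- `e^{tA*}`, the adjoint of `e^{tA}`. -/
noncomputable def expAdj (D : Coefficients H K U) (t : ℝ) : H →L[ℝ] H :=
  ContinuousLinearMap.adjoint (D.expA t)

/-- `B R⁻¹ B*`. -/
noncomputable def BRB (D : Coefficients H K U) : H →L[ℝ] H :=
  D.B ∘L D.R.inverse ∘L ContinuousLinearMap.adjoint D.B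

/-- `σ σ* P`. -/
noncomputable def diffusionOp (D : Coefficients H K U) (P : H →L[ℝ] H) : H →L[ℝ] H :=
  D.σ ∘L ContinuousLinearMap.adjoint D.σ ∘L P

/-- `P ∈ C_s([0,T]; Σ⁺(H))` is a mild solution of the backward Riccati equation
`P' + P A + A* P - P B R⁻¹ B* P + Q + Q̄ = 0`, `P(T) = Q_T + Q̄_T`. -/
def IsMildRiccati (D : Coefficients H K U) (T : ℝ) (P : ℝ → H →L[ℝ] H) : Prop :=
  IsStronglyContPos T P ∧
    ∀ x : H, ∀ t ∈ Icc 0 T,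
      P t x = D.expAdj (T - t) ((D.QT + D.QbarT) (D.expA (T - t) x))
        + (∫ s in t..T, D.expAdj (s - t) ((D.Q + D.Qbar) (D.expA (s - t) x)))
        - ∫ s in t..T, D.expAdj (s - t) (P s (D.BRB (P s (D.expA (s - t) x))))

/-- `(z, r) ∈ C([0,T]; H²)` is a mild solution of the forward-backward system
`z' = (A - B R⁻¹ B* P) z - B R⁻¹ B* r`, `z(0) = z₀`,
`r' + (A* - P B R⁻¹ B*) r - Q̄ S z = 0`, `r(T) = - Q̄_T S_T z(T)`. -/
structure IsMildForwardBackward (D : Coefficients H K U) (T : ℝ) (z₀ : H)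
    (P : ℝ → H →L[ℝ] H) (z r : ℝ → H) : Prop where
  continuousOn_z : ContinuousOn z (Icc 0 T)
  continuousOn_r : ContinuousOn r (Icc 0 T)
  z_eq : ∀ t ∈ Icc 0 T,
    z t = D.expA t z₀ - (∫ s in (0 : ℝ)..t, D.expA (t - s) (D.BRB (P s (z s))))
      - ∫ s in (0 : ℝ)..t, D.expA (t - s) (D.BRB (r s))
  r_eq : ∀ t ∈ Icc 0 T,
    r t = D.expAdj (T - t) (-(D.QbarT (D.ST (z T))))
      - (∫ s in t..T, D.expAdj (s - t) (P s (D.BRB (r s))))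
      - ∫ s in t..T, D.expAdj (s - t) (D.Qbar (D.S (z s)))

/-- `Tr[σ σ* P(t)]` makes sense for almost every `t ∈ [0,T]` and is integrable on `[0,T]`. -/
def HasIntegrableTrace (D : Coefficients H K U) (T : ℝ) (P : ℝ → H →L[ℝ] H) : Prop :=
  (∀ᵐ t ∂(volume.restrict (Icc 0 T)), IsTraceClass (D.diffusionOp (P t))) ∧
    IntegrableOn (fun t => operatorTrace (D.diffusionOp (P t))) (Icc 0 T)

/-- The LQM (linear-quadratic-mean) mild solutions of the mean field game with initial mean `z₀`. -/
structure IsLQMMildSolution (D : Coefficients H K U) (T : ℝ) (z₀ : H)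
    (P : ℝ → H →L[ℝ] H) (r z : ℝ → H) (s : ℝ → ℝ) : Prop where
  riccati : D.IsMildRiccati T P
  forwardBackward : D.IsMildForwardBackward T z₀ P z r
  integrableTrace : D.HasIntegrableTrace T P
  continuousOn_s : ContinuousOn s (Icc 0 T)
  s_eq : ∀ t ∈ Icc 0 T,
    s t = (1 / 2 : ℝ) * inner ℝ (D.QbarT (D.ST (z T))) (D.ST (z T))
      + ∫ u in t..T, ((1 / 2 : ℝ) * operatorTrace (D.diffusionOp (P u))
          - (1 / 2 : ℝ) * inner ℝ (D.BRB (r u)) (r u)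
          + (1 / 2 : ℝ) * inner ℝ (D.Qbar (D.S (z u))) (D.S (z u)))

/-- `η : [0,T] → Σ(H)` is a strict solution of the Riccati equation
`η' = (P B R⁻¹ B* - A_n*) η - η (A_n - B R⁻¹ B* P) + Q̄ S + η B R⁻¹ B* η`,
`η(T) = - Q̄_T S_T`, with a bounded operator `An` in place of `A_n`. At the end points of `[0,T]`
the derivative is one-sided. -/
structure IsStrictRiccati (D : Coefficients H K U) (T : ℝ) (P : ℝ → H →L[ℝ] H)
    (An : H →L[ℝ] H) (η : ℝ → H →L[ℝ] H) : Prop where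
  selfAdjoint : ∀ t ∈ Icc 0 T, IsSelfAdjoint (η t)
  terminal : η T = -(D.QbarT ∘L D.ST)
  hasDeriv : ∀ t ∈ Icc 0 T, ∀ x : H,
    HasDerivWithinAt (fun u => η u x)
      ((P t (D.BRB (η t x)) - ContinuousLinearMap.adjoint An (η t x))
        - η t (An x - D.BRB (P t x))
        + D.Qbar (D.S x) + η t (D.BRB (η t x)))
      (Icc 0 T) t

/-- For all sufficiently large `n` the Riccati equation with the Yosida approximation `A_n` of `A`
has a strict solution `η_n`, and `‖η_n(t)‖` is bounded uniformly in `n` and `t ∈ [0,T]`. -/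
def YosidaRiccatiSolvable (D : Coefficients H K U) (T : ℝ) (P : ℝ → H →L[ℝ] H) : Prop :=
  ∃ (N : ℕ) (C : ℝ), ∀ n ≥ N, ∃ η : ℝ → H →L[ℝ] H,
    D.IsStrictRiccati T P (yosida D.A n) η ∧ ∀ t ∈ Icc 0 T, ‖η t‖ ≤ C

end Coefficients

end Game

end LQMFG

/-! The Riccati equation is solved by monotone bounds and contraction, and the forward-backward
system by decoupling it for the Yosida approximations and passing to a weak limit; the scalar
component is then an explicit integral.

Riccati (`exists_mild_riccati`). The solution `V` of the Lyapunov equation without the quadratic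
term bounds every candidate from above. Adding `lam • P` to the source, and compensating by a
discount `exp (-lam * ·)`, makes the right-hand side nonnegative on the order interval between `0`
and `V`. The discounted map thus preserves this interval and contracts in an exponentially weighted
norm. `lyapunovMap_shift` shows that the discounted and the original equations agree.

Approximation. With the bounded operator `A_n` in place of `A`, the ansatz `r = η_n z` reduces the
coupled two-point problem to a linear forward equation for `z`, and (H1) makes `r` satisfy the
backward equation (`IsStrictRiccati.exists_forwardBackward`). By (H2), Grönwall's inequality and the
uniform bound on `exp (t A_n)`, the pairs `(z_n, r_n)` are bounded uniformly in `n`.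

Limit (`exists_isMildForwardBackward`). A subsequence converges weakly in `L²(0,T;H)` to a pair `(Z,
R)`. The system is linear, so weak convergence suffices: paired with a fixed vector, each Volterra
integral moves its operators onto that vector, where they converge strongly. This needs strong
convergence both of `exp (t A_n)` and of the adjoints (`tendsto_exp_yosida`). The latter comes from
norm convergence after composition with a squared resolvent, a property that survives taking
adjoints. The limiting formulas define continuous `z, r`, which are pointwise weak limits of `z_n,
r_n`, hence agree almost everywhere with `Z, R` and solve the mild system. -/

namespace LQMFG

/-! ### Strongly continuous operator families -/

section StrongContinuity

variable {X Y : Type*} [NormedAddCommGroup X] [NormedSpace ℝ X] [CompleteSpace X]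
  [NormedAddCommGroup Y] [NormedSpace ℝ Y]

/-- Strongly continuous operator families are bounded on compact intervals. -/
theorem exists_norm_le_of_strongly_continuous {F : ℝ → X →L[ℝ] Y}
    (hF : ∀ x, Continuous fun t => F t x) (a b : ℝ) :
    ∃ C, 0 < C ∧ ∀ t ∈ Icc a b, ‖F t‖ ≤ C := by
  have h : ∀ x, ∃ C, ∀ t : Icc a b, ‖F t x‖ ≤ C := by
    intro x
    obtain ⟨C, hC⟩ := isCompact_Icc.exists_bound_of_continuousOn (hF x).continuousOn (s := Icc a b)
    exact ⟨C, fun t => hC t t.2⟩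
  obtain ⟨C, hC⟩ := banach_steinhaus h
  exact ⟨max C 1, by positivity, fun t ht => (hC ⟨t, ht⟩).trans (le_max_left _ _)⟩

/-- The uniform boundedness principle bounds `F` near `t`, and this local bound controls the
variation of the vector. Joint continuity is what allows a strongly continuous family to be applied
to a moving vector. -/
theorem continuous_uncurry_of_strongly_continuous {F : ℝ → X →L[ℝ] Y}
    (hF : ∀ x, Continuous fun t => F t x) : Continuous fun p : ℝ × X => F p.1 p.2 := by
  rw [continuous_iff_continuousAt]
  rintro ⟨t, x⟩
  obtain ⟨C, hC0, hC⟩ := exists_norm_le_of_strongly_continuous hF (t - 1) (t + 1)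
  rw [ContinuousAt, tendsto_iff_norm_sub_tendsto_zero]
  have h1 : Tendsto (fun p : ℝ × X => C * ‖p.2 - x‖ + ‖F p.1 x - F t x‖) (𝓝 (t, x)) (𝓝 0) := by
    have hc : Continuous fun p : ℝ × X => C * ‖p.2 - x‖ + ‖F p.1 x - F t x‖ := by
      have := (hF x).comp (continuous_fst (X := ℝ) (Y := X))
      simp only [Function.comp_def] at this
      fun_prop
    simpa using hc.tendsto (t, x)
  refine squeeze_zero' (Eventually.of_forall fun _ => norm_nonneg _) ?_ h1
  have hmem : ∀ᶠ p : ℝ × X in 𝓝 (t, x), p.1 ∈ Icc (t - 1) (t + 1) :=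
    continuous_fst.continuousAt.eventually (Icc_mem_nhds (by simp) (by simp))
  filter_upwards [hmem] with p hp
  calc ‖F p.1 p.2 - F t x‖ = ‖F p.1 (p.2 - x) + (F p.1 x - F t x)‖ := by
        rw [map_sub]; congr 1; abel
    _ ≤ ‖F p.1 (p.2 - x)‖ + ‖F p.1 x - F t x‖ := norm_add_le _ _
    _ ≤ C * ‖p.2 - x‖ + ‖F p.1 x - F t x‖ := by
        gcongr
        exact (F p.1).le_of_opNorm_le (hC _ hp) _

theorem continuous_clm_apply_of_strongly_continuous {F : ℝ → X →L[ℝ] Y}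
    (hF : ∀ x, Continuous fun t => F t x) {α : Type*} [TopologicalSpace α] {τ : α → ℝ} {u : α → X}
    (hτ : Continuous τ) (hu : Continuous u) : Continuous fun a => F (τ a) (u a) :=
  (continuous_uncurry_of_strongly_continuous hF).comp (hτ.prodMk hu)

theorem aestronglyMeasurable_clm_apply {F : ℝ → X →L[ℝ] Y}
    (hF : ∀ x, Continuous fun t => F t x) {μ : Measure ℝ} {τ : ℝ → ℝ} {u : ℝ → X}
    (hτ : Continuous τ) (hu : AEStronglyMeasurable u μ) :
    AEStronglyMeasurable (fun a => F (τ a) (u a)) μ :=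
  (continuous_uncurry_of_strongly_continuous hF).comp_aestronglyMeasurable
    (hτ.aestronglyMeasurable.prodMk hu)

/-- The strong integral of a strongly continuous operator family is a bounded operator. -/
theorem exists_clm_eq_intervalIntegral [CompleteSpace Y] {F : ℝ → X →L[ℝ] Y}
    (hF : ∀ x, Continuous fun t => F t x) (a b : ℝ) :
    ∃ L : X →L[ℝ] Y, ∀ x, L x = ∫ s in a..b, F s x := by
  obtain ⟨C, -, hC⟩ := exists_norm_le_of_strongly_continuous hF (min a b) (max a b)
  refine ⟨LinearMap.mkContinuous
    { toFun := fun x => ∫ s in a..b, F s x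
      map_add' := fun x y => by
        simp only [map_add]
        exact intervalIntegral.integral_add ((hF x).intervalIntegrable _ _)
          ((hF y).intervalIntegrable _ _)
      map_smul' := fun c x => by
        simp only [map_smul, RingHom.id_apply]
        exact intervalIntegral.integral_smul _ _ } (C * |b - a|) ?_, fun x => rfl⟩
  intro x
  have : ‖∫ s in a..b, F s x‖ ≤ C * ‖x‖ * |b - a| :=
    intervalIntegral.norm_integral_le_of_norm_le_const fun s hs =>
      (F s).le_of_opNorm_le (hC s (uIoc_subset_uIcc hs)) x
  calc _ ≤ C * ‖x‖ * |b - a| := this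
    _ = C * |b - a| * ‖x‖ := by ring

end StrongContinuity

/-! ### Growth and continuity of `C₀`-semigroups -/

section Semigroup

variable {H : Type*} [NormedAddCommGroup H] [InnerProductSpace ℝ H] {E : ℝ → H →L[ℝ] H}

theorem IsC0Semigroup.apply_add (hE : IsC0Semigroup E) {s t : ℝ} (hs : 0 ≤ s) (ht : 0 ≤ t) (x : H) :
    E (s + t) x = E s (E t x) := by
  rw [hE.add s t hs ht]; rfl

theorem IsC0Semigroup.apply_zero (hE : IsC0Semigroup E) (x : H) : E 0 x = x := by
  rw [hE.zero]; rfl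

variable [CompleteSpace H]

/-- A `C₀`-semigroup is bounded near `0`. -/
theorem IsC0Semigroup.exists_local_bound (hE : IsC0Semigroup E) :
    ∃ δ > 0, ∃ M, 1 ≤ M ∧ ∀ t ∈ Icc 0 δ, ‖E t‖ ≤ M := by
  by_contra hcon
  push Not at hcon
  -- The bound is assumed to fail for `δ = 1/(n+1)` and `M = n+1`. Since `n + 1 ≥ 1 ≥ ‖E 0‖`, the
  -- bad times are positive, so they tend to `0` from the right. Strong convergence along them then
  -- contradicts Banach–Steinhaus.
  have hn : ∀ n : ℕ, ∃ t ∈ Icc (0 : ℝ) (1 / ((n : ℝ) + 1)), (n : ℝ) + 1 < ‖E t‖ := fun n =>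
    hcon _ (by positivity) _ (by linarith [(Nat.cast_nonneg n : (0 : ℝ) ≤ n)])
  choose t ht hbig using hn
  have ht0 : ∀ n, 0 < t n := by
    intro n
    rcases (ht n).1.eq_or_lt with h | h
    · exfalso
      have := hbig n
      rw [← h, hE.zero] at this
      have h1 := ContinuousLinearMap.norm_id_le (𝕜 := ℝ) (E := H)
      linarith [(Nat.cast_nonneg n : (0 : ℝ) ≤ n)]
    · exact h
  have hlim : Tendsto t atTop (𝓝[>] 0) := by
    refine tendsto_nhdsWithin_iff.2 ⟨?_, Eventually.of_forall ht0⟩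
    exact squeeze_zero (fun n => (ht0 n).le) (fun n => (ht n).2)
      tendsto_one_div_add_atTop_nhds_zero_nat
  have hb : ∀ x, ∃ C, ∀ n, ‖E (t n) x‖ ≤ C := by
    intro x
    obtain ⟨C, hC⟩ := ((hE.tendsto_zero x).comp hlim).norm.bddAbove_range
    exact ⟨C, fun n => hC ⟨n, rfl⟩⟩
  obtain ⟨C, hC⟩ := banach_steinhaus hb
  obtain ⟨n, hn⟩ := exists_nat_gt C
  linarith [hC n, hbig n]

/-- Exponential growth bound of a `C₀`-semigroup. -/
theorem IsC0Semigroup.exists_growth_bound (hE : IsC0Semigroup E) :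
    ∃ M ω : ℝ, 1 ≤ M ∧ 0 ≤ ω ∧ ∀ t, 0 ≤ t → ‖E t‖ ≤ M * Real.exp (ω * t) := by
  obtain ⟨δ, hδ, M, hM, hb⟩ := hE.exists_local_bound
  have hM0 : 0 < M := by linarith
  have hlog : 0 ≤ Real.log M := Real.log_nonneg hM
  refine ⟨M, Real.log M / δ, hM, by positivity, ?_⟩
  -- Each step of length `δ` costs one factor `M = exp (log M)`, which explains the rate `log M /
  -- δ`.
  have key : ∀ n : ℕ, ∀ t ∈ Icc (0 : ℝ) δ, ‖E (n * δ + t)‖ ≤ M ^ (n + 1) := by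
    intro n
    induction n with
    | zero => intro t ht; simpa using hb t ht
    | succ n ih =>
      intro t ht
      have e : ((n + 1 : ℕ) : ℝ) * δ + t = δ + (n * δ + t) := by push_cast; ring
      rw [e, hE.add _ _ hδ.le (by have := ht.1; positivity)]
      calc _ ≤ ‖E δ‖ * ‖E (n * δ + t)‖ := ContinuousLinearMap.opNorm_comp_le _ _
        _ ≤ M * M ^ (n + 1) := by
          gcongr
          · exact hb δ ⟨hδ.le, le_rfl⟩
          · exact ih t ht
        _ = M ^ (n + 1 + 1) := by ring
  intro t ht
  set n := ⌊t / δ⌋₊ with hn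
  have h1 : (n : ℝ) ≤ t / δ := Nat.floor_le (by positivity)
  have h2 : t / δ < n + 1 := Nat.lt_floor_add_one _
  have h1' : (n : ℝ) * δ ≤ t := (le_div_iff₀ hδ).1 h1
  have h2' : t < (n + 1) * δ := (div_lt_iff₀ hδ).1 h2
  have hk := key n (t - n * δ) ⟨by linarith, by linarith⟩
  rw [add_sub_cancel] at hk
  refine hk.trans ?_
  rw [pow_succ, mul_comm]
  gcongr
  calc M ^ n = Real.exp (Real.log M * n) := by
        rw [mul_comm, Real.exp_nat_mul, Real.exp_log hM0]
    _ ≤ Real.exp (Real.log M / δ * t) := by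
        apply Real.exp_le_exp.2
        calc Real.log M * n ≤ Real.log M * (t / δ) := by gcongr
          _ = _ := by ring

/-- For `s ≤ t` the increment factors as `E s (E (t - s) x - x)`. The growth bound therefore reduces
left and right continuity at any time to right continuity at `0`. -/
theorem IsC0Semigroup.continuousOn (hE : IsC0Semigroup E) (x : H) :
    ContinuousOn (fun t => E t x) (Ici 0) := by
  obtain ⟨M, ω, hM, hω, hb⟩ := hE.exists_growth_bound
  have hgen : ∀ s t : ℝ, 0 ≤ s → s ≤ t →
      ‖E t x - E s x‖ ≤ M * Real.exp (ω * t) * ‖E |t - s| x - x‖ := by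
    intro s t hs hst
    have e : E t x = E s (E (t - s) x) := by
      rw [← hE.apply_add hs (sub_nonneg.2 hst)]; congr 2; ring
    rw [abs_of_nonneg (sub_nonneg.2 hst), e, ← map_sub]
    refine (E s).le_of_opNorm_le ((hb s hs).trans ?_) _
    gcongr
  have h0 : Tendsto (fun h => E h x) (𝓝[≥] 0) (𝓝 x) := by
    rw [← Ioi_insert, nhdsWithin_insert]
    refine Tendsto.sup ?_ (hE.tendsto_zero x)
    have : E 0 x = x := hE.apply_zero x
    simpa [this] using tendsto_pure_nhds (fun h => E h x) 0
  intro t ht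
  rw [ContinuousWithinAt, tendsto_iff_norm_sub_tendsto_zero]
  have habs : Tendsto (fun s : ℝ => |s - t|) (𝓝[Ici 0] t) (𝓝[≥] 0) := by
    refine tendsto_nhdsWithin_iff.2 ⟨?_, Eventually.of_forall fun s => abs_nonneg (s - t)⟩
    have : Continuous fun s : ℝ => |s - t| := by fun_prop
    simpa using (this.tendsto t).mono_left nhdsWithin_le_nhds
  have hlim : Tendsto (fun s => M * Real.exp (ω * (s + t)) * ‖E |s - t| x - x‖) (𝓝[Ici 0] t)
      (𝓝 (M * Real.exp (ω * (t + t)) * 0)) := by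
    refine Tendsto.mul ?_ ?_
    · have : Continuous fun s : ℝ => M * Real.exp (ω * (s + t)) := by fun_prop
      exact (this.tendsto t).mono_left nhdsWithin_le_nhds
    · exact tendsto_iff_norm_sub_tendsto_zero.1 (h0.comp habs)
  rw [mul_zero] at hlim
  refine squeeze_zero' (Eventually.of_forall fun _ => norm_nonneg _) ?_ hlim
  filter_upwards [self_mem_nhdsWithin] with s hs
  have hs : 0 ≤ s := hs
  have ht : 0 ≤ t := ht
  rcases le_total s t with h | h
  · rw [norm_sub_rev, abs_sub_comm]
    refine (hgen s t hs h).trans ?_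
    gcongr
    linarith
  · refine (hgen t s ht h).trans ?_
    gcongr
    linarith

/-- Freezing the family at `E 0` for negative times gives continuity on the whole line, as required
by the lemmas on strongly continuous families and parametric integrals. -/
theorem IsC0Semigroup.continuous_max (hE : IsC0Semigroup E) (x : H) :
    Continuous fun t => E (max t 0) x :=
  (hE.continuousOn x).comp_continuous (by fun_prop) fun t => le_max_right t 0

end Semigroup

/-! ### Laplace bounds and resolvent algebra -/

section ResolventAlgebra

variable {H : Type*} [NormedAddCommGroup H] [InnerProductSpace ℝ H] {ω l : ℝ} {J : H →L[ℝ] H}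

theorem norm_laplace_le (hl : ω < l) {c : ℝ} {f : ℝ → H}
    (hf : ∀ t, 0 ≤ t → ‖f t‖ ≤ c * Real.exp (ω * t)) :
    ‖∫ t in Ioi (0 : ℝ), Real.exp (-l * t) • f t‖ ≤ c / (l - ω) := by
  have hg : IntegrableOn (fun t => c * Real.exp ((ω - l) * t)) (Ioi 0) :=
    (integrableOn_exp_mul_Ioi (by linarith) 0).const_mul c
  refine (norm_integral_le_of_norm_le hg ?_).trans ?_
  · filter_upwards [ae_restrict_mem measurableSet_Ioi] with t ht
    have ht : 0 < t := ht
    rw [norm_smul, Real.norm_of_nonneg (Real.exp_nonneg _)]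
    calc _ ≤ Real.exp (-l * t) * (c * Real.exp (ω * t)) := by gcongr; exact hf t ht.le
      _ = c * Real.exp ((ω - l) * t) := by
        rw [mul_left_comm, ← Real.exp_add]; congr 2; ring
  · rw [integral_const_mul, integral_exp_mul_Ioi (by linarith)]
    apply le_of_eq
    have h1 : l - ω ≠ 0 := by linarith
    have h2 : ω - l ≠ 0 := by linarith
    simp only [mul_zero, Real.exp_zero]
    rw [div_eq_mul_inv, div_eq_mul_inv, ← neg_sub l ω, inv_neg]
    ring

theorem IsResolvent.unique {A : H →ₗ.[ℝ] H} {J J' : H →L[ℝ] H} (h : IsResolvent A l J)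
    (h' : IsResolvent A l J') : J = J' := by
  ext y
  obtain ⟨x, hx, hy⟩ := h'.1 y
  rw [← hx, ← h.2 x, hy]

theorem IsResolvent.resolventOp_eq {A : H →ₗ.[ℝ] H} (h : IsResolvent A l J) :
    resolventOp A l = J := by
  have hex : ∃ J : H →L[ℝ] H, IsResolvent A l J := ⟨J, h⟩
  rw [resolventOp, dif_pos hex]
  exact hex.choose_spec.unique h

/-- The resolvent identity. -/
theorem IsResolvent.apply_sub {A : H →ₗ.[ℝ] H} {m : ℝ} {J' : H →L[ℝ] H} (h : IsResolvent A l J)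
    (h' : IsResolvent A m J') (y : H) : J' y - J y = (l - m) • J' (J y) := by
  obtain ⟨x, hx, hy⟩ := h.1 y
  have := h'.2 x
  have e : m • (x : H) - A x = y - (l - m) • J y := by rw [← hx, ← hy]; module
  rw [e, map_sub, map_smul, hx] at this
  rw [← sub_eq_zero, ← sub_eq_zero.2 this]
  abel

theorem IsResolvent.injective {A : H →ₗ.[ℝ] H} (h : IsResolvent A l J) :
    Function.Injective J := by
  rw [injective_iff_map_eq_zero]
  intro y hy
  obtain ⟨x, hx, hxy⟩ := h.1 y
  have : x = 0 := by ext; rw [hx, hy]; rfl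
  rw [← hxy, this]
  simp

theorem IsResolvent.denseRange {A : H →ₗ.[ℝ] H} (h : IsResolvent A l J)
    (hA : Dense (A.domain : Set H)) : DenseRange J :=
  hA.mono fun x hx => ⟨_, h.2 ⟨x, hx⟩⟩

end ResolventAlgebra

/-! ### The resolvent as the Laplace transform of the semigroup -/

section Resolvent

variable {H : Type*} [NormedAddCommGroup H] [InnerProductSpace ℝ H] [CompleteSpace H]
  {E : ℝ → H →L[ℝ] H} {M ω l : ℝ}

theorem IsC0Semigroup.integrableOn_laplace (hE : IsC0Semigroup E)
    (hl : ω < l) {c : ℝ} (x : H) (hx : ∀ t, 0 ≤ t → ‖E t x‖ ≤ c * Real.exp (ω * t)) :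
    IntegrableOn (fun t => Real.exp (-l * t) • E t x) (Ioi 0) := by
  have hg : IntegrableOn (fun t => c * Real.exp ((ω - l) * t)) (Ioi 0) :=
    (integrableOn_exp_mul_Ioi (by linarith) 0).const_mul c
  refine Integrable.mono' hg ?_ ?_
  · refine ContinuousOn.aestronglyMeasurable ?_ measurableSet_Ioi
    refine ContinuousOn.smul (by fun_prop) ?_
    exact (hE.continuousOn x).mono Ioi_subset_Ici_self
  · filter_upwards [ae_restrict_mem measurableSet_Ioi] with t ht
    have ht : 0 < t := ht
    rw [norm_smul, Real.norm_of_nonneg (Real.exp_nonneg _)]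
    calc _ ≤ Real.exp (-l * t) * (c * Real.exp (ω * t)) := by gcongr; exact hx t ht.le
      _ = c * Real.exp ((ω - l) * t) := by
        rw [mul_left_comm, ← Real.exp_add]; congr 2; ring

/-- `J` is the Laplace transform of the semigroup `E` at `l`. -/
def IsLaplaceTransform (E : ℝ → H →L[ℝ] H) (l : ℝ) (J : H →L[ℝ] H) : Prop :=
  ∀ x, J x = ∫ t in Ioi (0 : ℝ), Real.exp (-l * t) • E t x

theorem IsC0Semigroup.exists_isLaplaceTransform (hE : IsC0Semigroup E)
    (hb : ∀ t, 0 ≤ t → ‖E t‖ ≤ M * Real.exp (ω * t)) (hl : ω < l) :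
    ∃ J, IsLaplaceTransform E l J := by
  have hx : ∀ x : H, ∀ t, 0 ≤ t → ‖E t x‖ ≤ M * ‖x‖ * Real.exp (ω * t) := fun x t ht => by
    calc _ ≤ _ := (E t).le_of_opNorm_le (hb t ht) x
      _ = _ := by ring
  refine ⟨LinearMap.mkContinuous
    { toFun := fun x => ∫ t in Ioi (0 : ℝ), Real.exp (-l * t) • E t x
      map_add' := fun x y => by
        simp only [map_add, smul_add]
        exact integral_add (hE.integrableOn_laplace hl x (hx x))
          (hE.integrableOn_laplace hl y (hx y))
      map_smul' := fun c x => by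
        simp only [map_smul, RingHom.id_apply]
        rw [← integral_smul]
        congr 1
        ext t
        exact smul_comm _ _ _ } (M / (l - ω)) ?_, fun x => rfl⟩
  intro x
  calc _ ≤ M * ‖x‖ / (l - ω) := norm_laplace_le hl (hx x)
    _ = M / (l - ω) * ‖x‖ := by ring

variable {J : H →L[ℝ] H}

theorem IsLaplaceTransform.apply_semigroup (hJ : IsLaplaceTransform E l J) (hE : IsC0Semigroup E)
    (hb : ∀ t, 0 ≤ t → ‖E t‖ ≤ M * Real.exp (ω * t)) (hl : ω < l) {h : ℝ} (hh : 0 ≤ h) (x : H) :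
    E h (J x) = J (E h x) := by
  have hx : ∀ t, 0 ≤ t → ‖E t x‖ ≤ M * ‖x‖ * Real.exp (ω * t) := fun t ht => by
    calc _ ≤ _ := (E t).le_of_opNorm_le (hb t ht) x
      _ = _ := by ring
  rw [hJ, hJ, ← (E h).integral_comp_comm (hE.integrableOn_laplace hl x hx)]
  refine setIntegral_congr_fun measurableSet_Ioi fun t ht => ?_
  have ht : 0 < t := ht
  simp only [map_smul]
  rw [← hE.apply_add hh ht.le, ← hE.apply_add ht.le hh, add_comm]

/-- A translation turns `E h (J x)` into a scalar multiple of the tail of the Laplace integral. Then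
`h` enters only through an exponential and an integration limit, so the orbit of `J x` is
differentiable for every `x`. -/
theorem IsLaplaceTransform.semigroup_apply (hJ : IsLaplaceTransform E l J) (hE : IsC0Semigroup E)
    (hb : ∀ t, 0 ≤ t → ‖E t‖ ≤ M * Real.exp (ω * t)) (hl : ω < l) {h : ℝ} (hh : 0 ≤ h) (x : H) :
    E h (J x) = Real.exp (l * h) • (J x - ∫ t in (0 : ℝ)..h, Real.exp (-l * t) • E (max t 0) x) := by
  have hx : ∀ t, 0 ≤ t → ‖E t x‖ ≤ M * ‖x‖ * Real.exp (ω * t) := fun t ht => by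
    calc _ ≤ _ := (E t).le_of_opNorm_le (hb t ht) x
      _ = _ := by ring
  have hint := hE.integrableOn_laplace hl x hx
  have e1 : ∫ t in (0 : ℝ)..h, Real.exp (-l * t) • E (max t 0) x
      = ∫ t in (0 : ℝ)..h, Real.exp (-l * t) • E t x := by
    refine intervalIntegral.integral_congr fun t ht => ?_
    rw [uIcc_of_le hh] at ht
    simp only [max_eq_left ht.1]
  have e2 : J x - ∫ t in (0 : ℝ)..h, Real.exp (-l * t) • E (max t 0) x
      = ∫ t in Ioi h, Real.exp (-l * t) • E t x := by
    rw [e1, hJ, ← intervalIntegral.integral_interval_add_Ioi hint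
      (hint.mono_set (Ioi_subset_Ioi hh))]
    abel
  have e3 := (measurePreserving_add_right (volume : Measure ℝ) h).setIntegral_preimage_emb
    (measurableEmbedding_addRight h) (fun t => Real.exp (-l * t) • E t x) (Ioi h)
  have e4 : (fun t => t + h) ⁻¹' Ioi h = Ioi (0 : ℝ) := by ext t; simp
  rw [e4] at e3
  rw [e2, ← e3, ← integral_smul, hJ, ← (E h).integral_comp_comm hint]
  refine setIntegral_congr_fun measurableSet_Ioi fun t ht => ?_
  have ht : 0 < t := ht
  simp only [map_smul, smul_smul]
  rw [← hE.apply_add hh ht.le, ← Real.exp_add, add_comm h t]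
  congr 2
  ring

theorem IsLaplaceTransform.hasDerivWithinAt (hJ : IsLaplaceTransform E l J) (hE : IsC0Semigroup E)
    (hb : ∀ t, 0 ≤ t → ‖E t‖ ≤ M * Real.exp (ω * t)) (hl : ω < l) {t : ℝ} (ht : 0 ≤ t) (x : H) :
    HasDerivWithinAt (fun h => E h (J x)) (E t (l • J x - x)) (Ici 0) t := by
  have hc : Continuous fun t => Real.exp (-l * t) • E (max t 0) x := by
    exact (Real.continuous_exp.comp (continuous_const.mul continuous_id)).smul (hE.continuous_max x)
  have h1 : HasDerivAt (fun h => ∫ t in (0 : ℝ)..h, Real.exp (-l * t) • E (max t 0) x)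
      (Real.exp (-l * t) • E (max t 0) x) t :=
    intervalIntegral.integral_hasDerivAt_right (hc.intervalIntegrable _ _)
      (hc.stronglyMeasurableAtFilter _ _) hc.continuousAt
  have h2 : HasDerivAt (fun h => Real.exp (l * h)) (Real.exp (l * t) * l) t := by
    simpa using ((hasDerivAt_id t).const_mul l).exp
  have h3 := h2.smul (h1.const_sub (J x))
  have h4 : HasDerivWithinAt (fun h => E h (J x)) _ (Ici 0) t :=
    h3.hasDerivWithinAt.congr (fun h hh => hJ.semigroup_apply hE hb hl hh x)
      (hJ.semigroup_apply hE hb hl ht x)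
  convert h4 using 1
  rw [map_sub, map_smul, hJ.semigroup_apply hE hb hl ht x, max_eq_left ht, smul_neg, smul_smul,
    smul_smul, ← Real.exp_add]
  have : l * t + -l * t = 0 := by ring
  rw [this, Real.exp_zero, one_smul, mul_comm l]
  abel

/-- The bound is on the whole orbit and has the same form before and after applying `J`, with the
constant divided by `l - ω`. It can thus be iterated, and the factor `M` is paid only once for all
powers of `J`. -/
theorem IsLaplaceTransform.norm_semigroup_apply_le (hJ : IsLaplaceTransform E l J)
    (hE : IsC0Semigroup E) (hb : ∀ t, 0 ≤ t → ‖E t‖ ≤ M * Real.exp (ω * t)) (hl : ω < l) {c : ℝ}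
    {x : H} (hx : ∀ t, 0 ≤ t → ‖E t x‖ ≤ c * Real.exp (ω * t)) {t : ℝ} (ht : 0 ≤ t) :
    ‖E t (J x)‖ ≤ c / (l - ω) * Real.exp (ω * t) := by
  rw [hJ.apply_semigroup hE hb hl ht, hJ]
  calc _ ≤ c * Real.exp (ω * t) / (l - ω) := by
        refine norm_laplace_le hl fun s hs => ?_
        rw [← hE.apply_add hs ht]
        refine (hx _ (by positivity)).trans (le_of_eq ?_)
        rw [mul_assoc, ← Real.exp_add]; congr 2; ring
    _ = _ := by ring

/-- The Hille–Yosida estimate for powers of the resolvent. -/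
theorem IsLaplaceTransform.norm_pow_le (hJ : IsLaplaceTransform E l J) (hE : IsC0Semigroup E)
    (hM : 1 ≤ M) (hb : ∀ t, 0 ≤ t → ‖E t‖ ≤ M * Real.exp (ω * t)) (hl : ω < l) (k : ℕ) :
    ‖J ^ k‖ ≤ M / (l - ω) ^ k := by
  have hlω : 0 < l - ω := by linarith
  refine ContinuousLinearMap.opNorm_le_bound _ (by positivity) fun x => ?_
  have key : ∀ k : ℕ, ∀ t, 0 ≤ t →
      ‖E t ((J ^ k) x)‖ ≤ M * ‖x‖ / (l - ω) ^ k * Real.exp (ω * t) := by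
    intro k
    induction k with
    | zero =>
      intro t ht
      calc _ ≤ _ := (E t).le_of_opNorm_le (hb t ht) x
        _ = _ := by simp; ring
    | succ k ih =>
      intro t ht
      rw [pow_succ', mul_apply_eq_comp]
      refine (hJ.norm_semigroup_apply_le hE hb hl ih ht).trans (le_of_eq ?_)
      field_simp
      ring
  have := key k 0 le_rfl
  rw [hE.apply_zero, mul_zero, Real.exp_zero, mul_one] at this
  calc _ ≤ _ := this
    _ = _ := by ring

/-- The derivative at `0` of the orbit of `J y` gives `A (J y) = l • J y - y`, the right inverse
property. For the left one, `J` commutes with the semigroup and hence with the difference quotients,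
so `J (A x)` is the same limit as for `J x`. -/
theorem IsLaplaceTransform.isResolvent (hJ : IsLaplaceTransform E l J) (hE : IsC0Semigroup E)
    (hb : ∀ t, 0 ≤ t → ‖E t‖ ≤ M * Real.exp (ω * t)) (hl : ω < l) {A : H →ₗ.[ℝ] H}
    (hA : IsGenerator A E) : IsResolvent A l J := by
  have hgen : ∀ y, Tendsto (fun h : ℝ => h⁻¹ • (E h (J y) - J y)) (𝓝[>] 0) (𝓝 (l • J y - y)) := by
    intro y
    have h := hJ.hasDerivWithinAt hE hb hl le_rfl y
    rw [hE.apply_zero, hasDerivWithinAt_iff_tendsto_slope] at h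
    have h' : Ici (0 : ℝ) \ {0} = Ioi 0 := by ext; simp [lt_iff_le_and_ne, eq_comm]
    rw [h'] at h
    refine h.congr fun s => ?_
    simp [slope_def_module, hE.apply_zero]
  have hgraph : ∀ y, (J y, l • J y - y) ∈ A.graph := fun y => (hA _ _).2 (hgen y)
  refine ⟨fun y => ?_, fun x => ?_⟩
  · obtain ⟨x, hx1, hx2⟩ := (LinearPMap.mem_graph_iff A).1 (hgraph y)
    simp only at hx1 hx2
    exact ⟨x, hx1, by rw [hx2, hx1]; abel⟩
  · have hx := (hA _ _).1 (A.mem_graph x)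
    have h1 := (J.continuous.tendsto _).comp hx
    have h2 : Tendsto (fun h : ℝ => h⁻¹ • (E h (J x) - J x)) (𝓝[>] 0) (𝓝 (J (A x))) := by
      refine h1.congr' ?_
      filter_upwards [self_mem_nhdsWithin] with h hh
      have hh : 0 < h := hh
      simp [hJ.apply_semigroup hE hb hl hh.le]
    have h3 := tendsto_nhds_unique h2 (hgen x)
    rw [map_sub, map_smul, h3]
    abel

/-- The orthogonal complement of the range of the adjoint is the kernel of `J`. -/
theorem denseRange_adjoint_of_injective (hJ : Function.Injective J) :
    DenseRange (ContinuousLinearMap.adjoint J) := by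
  have h := ContinuousLinearMap.orthogonal_range (ContinuousLinearMap.adjoint J)
  rw [ContinuousLinearMap.adjoint_adjoint] at h
  have hker : (J : H →ₗ[ℝ] H).ker = ⊥ := LinearMap.ker_eq_bot.2 hJ
  rw [hker] at h
  have := Submodule.topologicalClosure_eq_top_iff.2 h
  have h2 := (Submodule.dense_iff_topologicalClosure_eq_top).2 this
  have hr : ((ContinuousLinearMap.adjoint J : H →ₗ[ℝ] H).range : Set H)
      = range (ContinuousLinearMap.adjoint J) := by ext; simp
  rwa [hr] at h2

end Resolvent

/-! ### From convergence on a dense range to strong convergence -/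

section DenseConvergence

variable {H : Type*} [NormedAddCommGroup H] [NormedSpace ℝ H]

theorem tendsto_apply_zero_of_denseRange {ι : Type*} {f : Filter ι} {L : ι → H →L[ℝ] H} {C : ℝ}
    (hC : ∀ᶠ i in f, ‖L i‖ ≤ C) {d : H →L[ℝ] H} (hd : DenseRange d)
    (hL : Tendsto (fun i => (L i).comp d) f (𝓝 0)) (y : H) :
    Tendsto (fun i => L i y) f (𝓝 0) := by
  have h : ∀ x, Tendsto (fun i => L i (d x)) f (𝓝 0) := fun x =>
    ((ContinuousLinearMap.apply ℝ H x).continuous.tendsto (0 : H →L[ℝ] H)).comp hL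
  rw [Metric.tendsto_nhds]
  intro ε hε
  obtain ⟨x, hx⟩ := hd.exists_dist_lt y (ε := ε / (2 * (|C| + 1))) (by positivity)
  filter_upwards [hC, (Metric.tendsto_nhds.1 (h x)) (ε / 2) (by positivity)] with i hi hi'
  rw [dist_zero_right] at hi' ⊢
  rw [dist_eq_norm] at hx
  calc ‖L i y‖ = ‖L i (y - d x) + L i (d x)‖ := by rw [map_sub]; congr 1; abel
    _ ≤ ‖L i (y - d x)‖ + ‖L i (d x)‖ := norm_add_le _ _
    _ ≤ (|C| + 1) * ‖y - d x‖ + ‖L i (d x)‖ := by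
        gcongr
        exact (L i).le_of_opNorm_le (by linarith [le_abs_self C]) _
    _ < (|C| + 1) * (ε / (2 * (|C| + 1))) + ε / 2 := by
        have : 0 < |C| + 1 := by positivity
        gcongr
    _ = ε := by field_simp; ring

end DenseConvergence

/-! ### Exponentials of bounded operators -/

section Exponential

variable {H : Type*} [NormedAddCommGroup H] [NormedSpace ℝ H] [CompleteSpace H]

/-- The exponential series is estimated term by term. Bounds on all powers keep `M` outside the
exponential, which a bound on `‖J‖` alone would not. -/
theorem norm_exp_smul_le_of_norm_pow_le {J : H →L[ℝ] H} {M q a : ℝ}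
    (hJ : ∀ k : ℕ, ‖J ^ k‖ ≤ M * q ^ k) (ha : 0 ≤ a) :
    ‖NormedSpace.exp (a • J)‖ ≤ M * Real.exp (a * q) := by
  have h1 := NormedSpace.exp_series_hasSum_exp' (𝕂 := ℝ) (a • J)
  have h2 := (NormedSpace.exp_series_hasSum_exp' (𝕂 := ℝ) (a * q)).mul_left M
  rw [← Real.exp_eq_exp_ℝ] at h2
  rw [← h1.tsum_eq]
  refine tsum_of_norm_bounded h2 fun k => ?_
  rw [norm_smul, smul_pow, norm_smul, Real.norm_of_nonneg (by positivity),
    Real.norm_of_nonneg (by positivity), smul_eq_mul, mul_pow]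
  calc _ ≤ ((k.factorial : ℝ))⁻¹ * (a ^ k * (M * q ^ k)) := by gcongr; exact hJ k
    _ = _ := by ring

theorem exp_smul_sub_smul_id (J : H →L[ℝ] H) (a b t : ℝ) :
    NormedSpace.exp (t • (a • J - b • ContinuousLinearMap.id ℝ H))
      = Real.exp (-(t * b)) • NormedSpace.exp ((t * a) • J) := by
  let _ : NormedAlgebra ℚ (H →L[ℝ] H) := NormedAlgebra.restrictScalars ℚ ℝ _
  have e : t • (a • J - b • ContinuousLinearMap.id ℝ H)
      = algebraMap ℝ (H →L[ℝ] H) (-(t * b)) + (t * a) • J := by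
    rw [Algebra.algebraMap_eq_smul_one, ContinuousLinearMap.one_def]
    module
  rw [e, NormedSpace.exp_add_of_commute (Algebra.commutes _ _), ← NormedSpace.algebraMap_exp_comm,
    ← Real.exp_eq_exp_ℝ, Algebra.algebraMap_eq_smul_one, smul_mul_assoc, one_mul]

end Exponential

/-! ### Convergence of the Yosida approximations and of their adjoints -/

section Yosida

variable {H : Type*} [NormedAddCommGroup H] [InnerProductSpace ℝ H] [CompleteSpace H]
  {E : ℝ → H →L[ℝ] H} {A : H →ₗ.[ℝ] H} {M ω l : ℝ}

theorem IsC0Semigroup.isLaplaceTransform_resolventOp (hE : IsC0Semigroup E)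
    (hA : IsGenerator A E) (hb : ∀ t, 0 ≤ t → ‖E t‖ ≤ M * Real.exp (ω * t)) (hl : ω < l) :
    IsLaplaceTransform E l (resolventOp A l) ∧ IsResolvent A l (resolventOp A l) := by
  obtain ⟨J, hJ⟩ := hE.exists_isLaplaceTransform hb hl
  have h := hJ.isResolvent hE hb hl hA
  rw [h.resolventOp_eq]
  exact ⟨hJ, h⟩

/-- Splitting off the scalar factor leaves the exponent `-n + n²/(n - ω) = ω n/(n - ω)`, which is at
most `2 ω` once `n ≥ 2 ω`. -/
theorem norm_exp_yosida_le (hE : IsC0Semigroup E) (hA : IsGenerator A E) (hM : 1 ≤ M)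
    (hω : 0 ≤ ω) (hb : ∀ t, 0 ≤ t → ‖E t‖ ≤ M * Real.exp (ω * t)) {n : ℕ} (hn0 : 0 < n)
    (hn : 2 * ω ≤ n) {t : ℝ} (ht : 0 ≤ t) :
    ‖NormedSpace.exp (t • yosida A n)‖ ≤ M * Real.exp (2 * ω * t) := by
  have hn0' : (0 : ℝ) < n := by exact_mod_cast hn0
  have hnω : ω < n := by linarith
  have hnω' : 0 < (n : ℝ) - ω := by linarith
  obtain ⟨hJ, -⟩ := hE.isLaplaceTransform_resolventOp hA hb hnω
  rw [yosida, exp_smul_sub_smul_id, norm_smul, Real.norm_of_nonneg (Real.exp_nonneg _)]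
  have h1 : ‖NormedSpace.exp ((t * (n : ℝ) ^ 2) • resolventOp A n)‖
      ≤ M * Real.exp (t * (n : ℝ) ^ 2 * ((n : ℝ) - ω)⁻¹) := by
    refine norm_exp_smul_le_of_norm_pow_le (fun k => ?_) (by positivity)
    rw [inv_pow, ← div_eq_mul_inv]
    exact hJ.norm_pow_le hE hM hb hnω k
  calc _ ≤ Real.exp (-(t * n)) * (M * Real.exp (t * (n : ℝ) ^ 2 * ((n : ℝ) - ω)⁻¹)) := by gcongr
    _ = M * Real.exp (-(t * n) + t * (n : ℝ) ^ 2 * ((n : ℝ) - ω)⁻¹) := by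
        rw [Real.exp_add]; ring
    _ ≤ M * Real.exp (2 * ω * t) := by
        gcongr
        have e : -(t * n) + t * (n : ℝ) ^ 2 * ((n : ℝ) - ω)⁻¹ = t * ω * (n * ((n : ℝ) - ω)⁻¹) := by
          field_simp; ring
        rw [e]
        have h2 : (n : ℝ) * ((n : ℝ) - ω)⁻¹ ≤ 2 := by
          rw [← div_eq_mul_inv, div_le_iff₀ hnω']; linarith
        calc _ ≤ t * ω * 2 := by gcongr
          _ = _ := by ring

/-- The Yosida approximations converge on the range of `R(l, A)²`, with a rate. -/
theorem norm_exp_yosida_sub_le (hE : IsC0Semigroup E) (hA : IsGenerator A E) (hM : 1 ≤ M)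
    (hω : 0 ≤ ω) (hb : ∀ t, 0 ≤ t → ‖E t‖ ≤ M * Real.exp (ω * t)) (hl : ω < l) {n : ℕ}
    (hn0 : 0 < n) (hn : 2 * ω ≤ n) {t : ℝ} (ht : 0 ≤ t) (x : H) :
    ‖E t (resolventOp A l (resolventOp A l x))
        - NormedSpace.exp (t • yosida A n) (resolventOp A l (resolventOp A l x))‖
      ≤ M * Real.exp (2 * ω * t) * (M * Real.exp (ω * t)) * (M / (n - ω))
        * ‖l • resolventOp A l - ContinuousLinearMap.id ℝ H‖ ^ 2 * t * ‖x‖ := by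
  have hn0' : (0 : ℝ) < n := by exact_mod_cast hn0
  have hnω : ω < n := by linarith
  have hnω' : 0 < (n : ℝ) - ω := by linarith
  obtain ⟨hJn, hRn⟩ := hE.isLaplaceTransform_resolventOp hA hb hnω
  obtain ⟨hJ, hR⟩ := hE.isLaplaceTransform_resolventOp hA hb hl
  set Jn := resolventOp A (n : ℝ) with hJn_def
  set J := resolventOp A l with hJ_def
  set G := l • J - ContinuousLinearMap.id ℝ H with hG
  set An := yosida A n with hAn
  have hAnE : ∀ s, 0 ≤ s → ∀ y, An (E s y) = E s (An y) := by
    intro s hs y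
    simp only [hAn, yosida, _root_.sub_apply, _root_.smul_apply,
      ContinuousLinearMap.id_apply, map_sub, map_smul]
    rw [← hJn_def, hJn.apply_semigroup hE hb hnω hs]
  -- Formally `A - A_n = -J_n A²` and `A J = G`. The proof uses only the resolvent identity between
  -- `l` and `n`, so no unbounded operator appears.
  have halg : l • J (J x) - J x - An (J (J x)) = -Jn (G (G x)) := by
    have h1 := hR.apply_sub hRn (J x)
    have h2 := hR.apply_sub hRn x
    have h1' : J (J x) = Jn (J x) - (l - n) • Jn (J (J x)) := by rw [← h1]; abel
    have h2' : J x = Jn x - (l - n) • Jn (J x) := by rw [← h2]; abel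
    have e1 : An (J (J x)) = ((n : ℝ) ^ 2) • Jn (J (J x)) - (n : ℝ) • J (J x) := rfl
    have e2 : Jn (G (G x)) = (l ^ 2) • Jn (J (J x)) - (2 * l) • Jn (J x) + Jn x := by
      simp only [hG, _root_.sub_apply, _root_.smul_apply,
        ContinuousLinearMap.id_apply, map_sub, map_smul]
      module
    rw [e1, e2]
    calc l • J (J x) - J x - ((n : ℝ) ^ 2 • Jn (J (J x)) - (n : ℝ) • J (J x))
        = (l + n) • J (J x) - J x - (n : ℝ) ^ 2 • Jn (J (J x)) := by module
      _ = (l + n) • (Jn (J x) - (l - n) • Jn (J (J x))) - (Jn x - (l - n) • Jn (J x))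
          - (n : ℝ) ^ 2 • Jn (J (J x)) := by rw [← h1', ← h2']
      _ = _ := by module
  -- Interpolation between the two semigroups: `s = 0` gives `exp (t A_n)` and `s = t` gives `E t`.
  -- The derivative contains `A - A_n`, which is `O(1/n)` on the range of `J²`.
  have hderiv : ∀ s ∈ Icc 0 t, HasDerivWithinAt
      (fun s => NormedSpace.exp ((t - s) • An) (E s (J (J x))))
      (-NormedSpace.exp ((t - s) • An) (E s (Jn (G (G x))))) (Icc 0 t) s := by
    intro s hs
    have h1 := ((hasDerivAt_exp_smul_const An (t - s)).comp_const_sub t s).hasDerivWithinAt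
      (s := Icc 0 t)
    have h2 := (hJ.hasDerivWithinAt hE hb hl hs.1 (J x)).mono (Icc_subset_Ici_self : Icc 0 t ⊆ _)
    have h3 := h1.clm_apply h2
    convert h3 using 1
    rw [← map_neg, ← map_neg, ← halg, _root_.neg_apply,
      mul_apply_eq_comp, hAnE s hs.1, ← sub_eq_neg_add, ← map_sub, ← map_sub]
  have hbound : ∀ s ∈ Ico 0 t, ‖-NormedSpace.exp ((t - s) • An) (E s (Jn (G (G x))))‖
      ≤ M * Real.exp (2 * ω * t) * (M * Real.exp (ω * t)) * (M / (n - ω)) * ‖G‖ ^ 2 * ‖x‖ := by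
    intro s hs
    rw [norm_neg]
    have b1 : ‖NormedSpace.exp ((t - s) • An)‖ ≤ M * Real.exp (2 * ω * t) := by
      refine (norm_exp_yosida_le hE hA hM hω hb hn0 hn (by linarith [hs.2])).trans ?_
      gcongr
      linarith [hs.1]
    have b2 : ‖E s‖ ≤ M * Real.exp (ω * t) := by
      refine (hb s hs.1).trans ?_
      gcongr
      exact hs.2.le
    have b3 : ‖Jn‖ ≤ M / (n - ω) := by simpa using hJn.norm_pow_le hE hM hb hnω 1
    calc _ ≤ M * Real.exp (2 * ω * t) * ‖E s (Jn (G (G x)))‖ :=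
          ContinuousLinearMap.le_of_opNorm_le _ b1 _
      _ ≤ M * Real.exp (2 * ω * t) * (M * Real.exp (ω * t) * (M / (n - ω) * (‖G‖ * (‖G‖ * ‖x‖)))) := by
          gcongr
          refine ContinuousLinearMap.le_of_opNorm_le_of_le _ b2 ?_
          refine ContinuousLinearMap.le_of_opNorm_le_of_le _ b3 ?_
          exact ContinuousLinearMap.le_of_opNorm_le_of_le _ le_rfl (G.le_opNorm x)
      _ = _ := by ring
  have := norm_image_sub_le_of_norm_deriv_le_segment' hderiv hbound t ⟨ht, le_rfl⟩
  simp only [sub_self, zero_smul, NormedSpace.exp_zero, sub_zero, one_apply_eq_self,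
    hE.apply_zero] at this
  refine this.trans (le_of_eq (by ring))

theorem exists_forall_norm_exp_yosida_le (hE : IsC0Semigroup E) (hA : IsGenerator A E) (T : ℝ) :
    ∃ C : ℝ, 0 < C ∧ ∃ N : ℕ, ∀ n ≥ N, ∀ t ∈ Icc 0 T,
      ‖NormedSpace.exp (t • yosida A n)‖ ≤ C := by
  obtain ⟨M, ω, hM, hω, hb⟩ := hE.exists_growth_bound
  obtain ⟨N, hN⟩ := exists_nat_ge (2 * ω)
  refine ⟨M * Real.exp (2 * ω * T), by positivity, N + 1, fun n hn t ht => ?_⟩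
  have : (N : ℝ) ≤ n := by exact_mod_cast (Nat.le_succ N).trans hn
  refine (norm_exp_yosida_le hE hA hM hω hb (by lia) (by linarith) ht.1).trans ?_
  gcongr
  exact ht.2

/-- The exponentials of the Yosida approximations and their adjoints converge strongly. -/
theorem tendsto_exp_yosida (hE : IsC0Semigroup E) (hA : IsGenerator A E)
    (hdense : Dense (A.domain : Set H)) {t : ℝ} (ht : 0 ≤ t) (x : H) :
    Tendsto (fun n : ℕ => NormedSpace.exp (t • yosida A n) x) atTop (𝓝 (E t x)) ∧
    Tendsto (fun n : ℕ => ContinuousLinearMap.adjoint (NormedSpace.exp (t • yosida A n)) x) atTop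
      (𝓝 (ContinuousLinearMap.adjoint (E t) x)) := by
  obtain ⟨M, ω, hM, hω, hb⟩ := hE.exists_growth_bound
  have hl : ω < ω + 1 := by linarith
  obtain ⟨hJ, hR⟩ := hE.isLaplaceTransform_resolventOp hA hb hl
  set l := ω + 1 with hl_def
  set J := resolventOp A l with hJ_def
  obtain ⟨N₀, hN₀⟩ := exists_nat_ge (2 * ω)
  have hlarge : ∀ᶠ n : ℕ in atTop, 0 < n ∧ 2 * ω ≤ n := by
    filter_upwards [eventually_ge_atTop (N₀ + 1)] with n hn
    refine ⟨by lia, hN₀.trans ?_⟩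
    exact_mod_cast (Nat.le_succ N₀).trans hn
  set L : ℕ → H →L[ℝ] H := fun n => E t - NormedSpace.exp (t • yosida A n) with hL
  set c := M * Real.exp (2 * ω * t) * (M * Real.exp (ω * t))
  set g := ‖l • J - ContinuousLinearMap.id ℝ H‖
  have hrate : Tendsto (fun n : ℕ => c * (M / (n - ω)) * g ^ 2 * t) atTop (𝓝 0) := by
    have h1 : Tendsto (fun n : ℕ => (n : ℝ) - ω) atTop atTop :=
      tendsto_atTop_add_const_right _ (-ω) tendsto_natCast_atTop_atTop
    have h2 := ((h1.const_div_atTop M).const_mul c).mul_const (g ^ 2 * t)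
    simp only [mul_zero, zero_mul] at h2
    exact h2.congr fun n => by ring
  have hnorm : ∀ᶠ n : ℕ in atTop, ‖(L n).comp (J.comp J)‖ ≤ c * (M / (n - ω)) * g ^ 2 * t := by
    filter_upwards [hlarge] with n hn
    have hpos : 0 < (n : ℝ) - ω := by
      have : (0 : ℝ) < n := by exact_mod_cast hn.1
      linarith [hn.2]
    exact ContinuousLinearMap.opNorm_le_bound _ (by positivity) fun y =>
      norm_exp_yosida_sub_le hE hA hM hω hb hl hn.1 hn.2 ht y
  have hzero : Tendsto (fun n => (L n).comp (J.comp J)) atTop (𝓝 0) :=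
    squeeze_zero_norm' hnorm hrate
  have hbound : ∀ᶠ n in atTop, ‖L n‖ ≤ M * Real.exp (ω * t) + M * Real.exp (2 * ω * t) := by
    filter_upwards [hlarge] with n hn
    exact (norm_sub_le _ _).trans
      (add_le_add (hb t ht) (norm_exp_yosida_le hE hA hM hω hb hn.1 hn.2 ht))
  have hdJ : DenseRange (J.comp J) := by
    have := hR.denseRange hdense
    exact this.comp this J.continuous
  have hdJ' : DenseRange (ContinuousLinearMap.adjoint (J.comp J)) := by
    refine denseRange_adjoint_of_injective ?_
    exact hR.injective.comp hR.injective
  constructor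
  · have h := tendsto_apply_zero_of_denseRange hbound hdJ hzero x
    have h' := h.const_sub (E t x)
    simpa [hL] using h'
  -- Strong convergence does not pass to adjoints, but the norm convergence of `L n ∘ J²` does.
  -- Since `J` commutes with `L n`, the adjoint of this composition is `(L n)* ∘ (J²)*`, and `(J²)*`
  -- has dense range because `J²` is injective.
  · have hcomm : ∀ᶠ n in atTop, (L n).comp (J.comp J) = (J.comp J).comp (L n) := by
      filter_upwards [hlarge] with n hn
      have hn0' : (0 : ℝ) < n := by exact_mod_cast hn.1
      have hnω : ω < n := by linarith [hn.2]
      obtain ⟨-, hRn⟩ := hE.isLaplaceTransform_resolventOp hA hb hnω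
      -- The resolvent identity gives commutation only after division by `l - n`, so equality of the
      -- two parameters is treated separately.
      have hJJ : Commute J (resolventOp A (n : ℝ)) := by
        by_cases hln : l = n
        · rw [hJ_def, hln]
        · ext y
          have h1 := hR.apply_sub hRn y
          have h2 := hRn.apply_sub hR y
          have h3 : (l - n) • (resolventOp A (n : ℝ) (J y) - J (resolventOp A (n : ℝ) y)) = 0 := by
            rw [smul_sub, ← h1, ← neg_sub (n : ℝ) l, neg_smul, ← h2]; abel
          rcases smul_eq_zero.1 h3 with h | h
          · exact absurd (sub_eq_zero.1 h) hln
          · exact (sub_eq_zero.1 h).symm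
      have hJY : Commute J (yosida A n) :=
        (hJJ.smul_right _).sub_right ((Commute.one_right J).smul_right _)
      have hJE : Commute J (E t) := by
        ext y
        exact (hJ.apply_semigroup hE hb hl ht y).symm
      have hJL : Commute J (L n) := hJE.sub_right ((hJY.smul_right t).exp_right)
      exact ((hJL.mul_left hJL).eq).symm
    have hzero' : Tendsto (fun n => (ContinuousLinearMap.adjoint (L n)).comp
        (ContinuousLinearMap.adjoint (J.comp J))) atTop (𝓝 0) := by
      have h := ((ContinuousLinearMap.adjoint (𝕜 := ℝ) (E := H) (F := H)).continuous.tendsto _).comp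
        hzero
      rw [map_zero] at h
      refine h.congr' ?_
      filter_upwards [hcomm] with n hn
      rw [Function.comp_apply, hn, ContinuousLinearMap.adjoint_comp]
    have hbound' : ∀ᶠ n in atTop, ‖ContinuousLinearMap.adjoint (L n)‖
        ≤ M * Real.exp (ω * t) + M * Real.exp (2 * ω * t) := by
      filter_upwards [hbound] with n hn
      rwa [LinearIsometryEquiv.norm_map]
    have h := tendsto_apply_zero_of_denseRange hbound' hdJ' hzero' x
    have h' := h.const_sub (ContinuousLinearMap.adjoint (E t) x)
    simpa [hL] using h'

/-- The adjoint semigroup is a `C₀`-semigroup. -/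
theorem IsC0Semigroup.adjoint (hE : IsC0Semigroup E) (hA : IsGenerator A E) :
    IsC0Semigroup fun t => ContinuousLinearMap.adjoint (E t) where
  zero := by rw [hE.zero]; exact ContinuousLinearMap.adjoint_id
  add s t hs ht := by
    rw [add_comm, hE.add t s ht hs, ContinuousLinearMap.adjoint_comp]
  tendsto_zero y := by
    obtain ⟨M, ω, hM, hω, hb⟩ := hE.exists_growth_bound
    have hl : ω < ω + 1 := by linarith
    obtain ⟨hJ, hR⟩ := hE.isLaplaceTransform_resolventOp hA hb hl
    set l := ω + 1 with hl_def
    set J := resolventOp A l with hJ_def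
    set L : ℝ → H →L[ℝ] H := fun t => E t - ContinuousLinearMap.id ℝ H with hL
    set g := ‖l • J - ContinuousLinearMap.id ℝ H‖
    have hmem : ∀ᶠ t : ℝ in 𝓝[>] 0, t ∈ Ioo (0 : ℝ) 1 := Ioo_mem_nhdsGT one_pos
    have hb1 : ∀ t ∈ Icc (0 : ℝ) 1, ‖E t‖ ≤ M * Real.exp ω := fun t ht => by
      refine (hb t ht.1).trans ?_
      gcongr
      nlinarith [ht.1, ht.2]
    -- As for the Yosida exponentials, smoothing by `J` gives convergence in norm, here with rate
    -- `O(t)`, and the estimate transfers to the adjoints.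
    have hnorm : ∀ᶠ t : ℝ in 𝓝[>] 0, ‖(L t).comp J‖ ≤ M * Real.exp ω * g * t := by
      filter_upwards [hmem] with t ht
      have ht0 : 0 ≤ t := ht.1.le
      refine ContinuousLinearMap.opNorm_le_bound _ (by positivity) fun x => ?_
      have h := norm_image_sub_le_of_norm_deriv_le_segment' (f := fun s => E s (J x))
        (f' := fun s => E s (l • J x - x)) (a := 0) (b := t) (C := M * Real.exp ω * (g * ‖x‖))
        (fun s hs => (hJ.hasDerivWithinAt hE hb hl hs.1 x).mono Icc_subset_Ici_self)
        (fun s hs => ContinuousLinearMap.le_of_opNorm_le_of_le _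
          (hb1 s ⟨hs.1, (hs.2.trans ht.2).le⟩)
          ((l • J - ContinuousLinearMap.id ℝ H).le_opNorm x)) t ⟨ht0, le_rfl⟩
      simp only [hE.apply_zero, sub_zero] at h
      calc _ ≤ _ := h
        _ = _ := by ring
    have hzero : Tendsto (fun t => (L t).comp J) (𝓝[>] 0) (𝓝 0) := by
      refine squeeze_zero_norm' hnorm ?_
      have : Continuous fun t : ℝ => M * Real.exp ω * g * t := by fun_prop
      simpa using (this.tendsto 0).mono_left nhdsWithin_le_nhds
    have hzero' : Tendsto (fun t => (ContinuousLinearMap.adjoint (L t)).comp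
        (ContinuousLinearMap.adjoint J)) (𝓝[>] 0) (𝓝 0) := by
      have h := ((ContinuousLinearMap.adjoint (𝕜 := ℝ) (E := H) (F := H)).continuous.tendsto _).comp
        hzero
      rw [map_zero] at h
      refine h.congr' ?_
      filter_upwards [hmem] with t ht
      have hcomm : (L t).comp J = J.comp (L t) := by
        ext y
        simp [hL, hJ.apply_semigroup hE hb hl ht.1.le]
      rw [Function.comp_apply, hcomm, ContinuousLinearMap.adjoint_comp]
    have hbound : ∀ᶠ t in 𝓝[>] 0, ‖ContinuousLinearMap.adjoint (L t)‖ ≤ M * Real.exp ω + 1 := by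
      filter_upwards [hmem] with t ht
      rw [LinearIsometryEquiv.norm_map]
      exact (norm_sub_le _ _).trans (add_le_add (hb1 t ⟨ht.1.le, ht.2.le⟩)
        ContinuousLinearMap.norm_id_le)
    have h := tendsto_apply_zero_of_denseRange hbound (denseRange_adjoint_of_injective hR.injective)
      hzero' y
    have h' := h.add_const y
    have hid : ContinuousLinearMap.adjoint (ContinuousLinearMap.id ℝ H)
      = ContinuousLinearMap.id ℝ H := ContinuousLinearMap.adjoint_id
    simpa [hL, hid] using h'

end Yosida

/-! ### Weighted Picard iteration -/

section Picard

/-- A Picard iteration scheme that contracts in a weighted uniform norm has a fixed point. -/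
theorem exists_fixedPoint_of_weighted_contraction {Y : Type*} [NormedAddCommGroup Y]
    [CompleteSpace Y] {S : Set (ℝ → Y)} {Ψ : (ℝ → Y) → ℝ → Y} {w : ℝ → ℝ} {W : ℝ}
    (hw : ∀ t, w t ≤ W) (hΨ : ∀ F ∈ S, Ψ F ∈ S)
    (hcontr : ∀ F ∈ S, ∀ G ∈ S, ∀ c, 0 ≤ c → (∀ t, ‖F t - G t‖ ≤ c * w t) →
      ∀ t, ‖Ψ F t - Ψ G t‖ ≤ c / 2 * w t)
    {F₀ : ℝ → Y} (h₀ : F₀ ∈ S) {c₀ : ℝ} (hc₀ : 0 ≤ c₀) (h₁ : ∀ t, ‖F₀ t - Ψ F₀ t‖ ≤ c₀ * w t)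
    (hclosed : ∀ u : ℕ → ℝ → Y, (∀ k, u k ∈ S) → ∀ F, TendstoUniformly u F atTop → F ∈ S) :
    ∃ F ∈ S, Ψ F = F := by
  set u : ℕ → ℝ → Y := fun k => Ψ^[k] F₀ with hu
  have hsucc : ∀ k, u (k + 1) = Ψ (u k) := fun k => Function.iterate_succ_apply' Ψ k F₀
  have huS : ∀ k, u k ∈ S := by
    intro k
    induction k with
    | zero => exact h₀
    | succ k ih => rw [hsucc]; exact hΨ _ ih
  have hstep : ∀ k t, ‖u k t - u (k + 1) t‖ ≤ c₀ / 2 ^ k * w t := by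
    intro k
    induction k with
    | zero => intro t; simpa [hu] using h₁ t
    | succ k ih =>
      intro t
      have := hcontr _ (huS k) _ (huS (k + 1)) (c₀ / 2 ^ k) (by positivity) ih t
      rw [hsucc, hsucc (k + 1)]
      refine this.trans (le_of_eq ?_)
      rw [pow_succ]; ring
  have hgeom : ∀ t k, dist (u k t) (u (k + 1) t) ≤ 2 * c₀ * w t / 2 / 2 ^ k := fun t k => by
    rw [dist_eq_norm]
    refine (hstep k t).trans (le_of_eq ?_)
    ring
  have hlim : ∀ t, ∃ y, Tendsto (fun k => u k t) atTop (𝓝 y) := fun t =>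
    cauchySeq_tendsto_of_complete (cauchySeq_of_le_geometric_two (hgeom t))
  choose F hF using hlim
  have hdist : ∀ k t, ‖u k t - F t‖ ≤ 2 * c₀ / 2 ^ k * w t := fun k t => by
    rw [← dist_eq_norm]
    refine (dist_le_of_le_geometric_two_of_tendsto (hgeom t) (hF t) k).trans (le_of_eq ?_)
    ring
  have hpow : ∀ a : ℝ, Tendsto (fun k : ℕ => a / 2 ^ k) atTop (𝓝 0) := fun a =>
    (tendsto_pow_atTop_atTop_of_one_lt (by norm_num)).const_div_atTop a
  have hFS : F ∈ S := by
    refine hclosed u huS F ?_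
    rw [Metric.tendstoUniformly_iff]
    intro ε hε
    have h := hpow (2 * c₀ * W)
    filter_upwards [h.eventually (gt_mem_nhds hε)] with k hk t
    rw [dist_comm, dist_eq_norm]
    refine (hdist k t).trans_lt (lt_of_le_of_lt ?_ hk)
    calc _ ≤ 2 * c₀ / 2 ^ k * W := by gcongr; exact hw t
      _ = _ := by ring
  refine ⟨F, hFS, funext fun t => ?_⟩
  -- Applied to `u k` and the limit `F`, the contraction estimate itself supplies the continuity of
  -- `Ψ` along the iteration.
  have h1 : Tendsto (fun k => u (k + 1) t) atTop (𝓝 (Ψ F t)) := by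
    rw [tendsto_iff_norm_sub_tendsto_zero]
    have h2 : Tendsto (fun k : ℕ => c₀ * w t / 2 ^ k) atTop (𝓝 0) := hpow _
    refine squeeze_zero (fun k => norm_nonneg _) (fun k => ?_) h2
    rw [hsucc]
    refine (hcontr _ (huS k) _ hFS _ (by positivity) (hdist k) t).trans (le_of_eq ?_)
    ring
  exact tendsto_nhds_unique h1 ((tendsto_add_atTop_iff_nat 1).2 (hF t))

variable {Y : Type*} [NormedAddCommGroup Y] [NormedSpace ℝ Y]

/-- Integrating the weight gains a factor `1/μ`. A large `μ` thus turns a Lipschitz Volterra map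
into a contraction on the whole interval, without any smallness of `T`. -/
theorem norm_integral_le_exp_backward {f : ℝ → Y} {t T c μ : ℝ} (ht : t ≤ T) (hμ : 0 < μ)
    (hc : 0 ≤ c) (hf : ∀ s ∈ Icc t T, ‖f s‖ ≤ c * Real.exp (μ * (T - s))) :
    ‖∫ s in t..T, f s‖ ≤ c / μ * Real.exp (μ * (T - t)) := by
  have hcont : Continuous fun s => c * Real.exp (μ * (T - s)) := by fun_prop
  refine (intervalIntegral.norm_integral_le_of_norm_le ht
    (Eventually.of_forall fun s hs => hf s ⟨hs.1.le, hs.2⟩)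
    (hcont.intervalIntegrable _ _)).trans ?_
  have hd : ∀ s ∈ uIcc t T, HasDerivAt (fun s => -(c / μ) * Real.exp (μ * (T - s)))
      (c * Real.exp (μ * (T - s))) s := by
    intro s _
    have h1 : HasDerivAt (fun s => μ * (T - s)) (μ * -1) s :=
      ((hasDerivAt_id s).const_sub T).const_mul μ
    refine (h1.exp.const_mul (-(c / μ))).congr_deriv ?_
    field_simp
  rw [intervalIntegral.integral_eq_sub_of_hasDerivAt hd (hcont.intervalIntegrable _ _)]
  have : 0 ≤ c / μ * Real.exp (μ * (T - T)) := by positivity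
  linarith

theorem norm_integral_le_exp_forward {f : ℝ → Y} {t c μ : ℝ} (ht : 0 ≤ t) (hμ : 0 < μ)
    (hc : 0 ≤ c) (hf : ∀ s ∈ Icc 0 t, ‖f s‖ ≤ c * Real.exp (μ * s)) :
    ‖∫ s in (0 : ℝ)..t, f s‖ ≤ c / μ * Real.exp (μ * t) := by
  have h := norm_integral_le_exp_backward (f := fun s => f (t - s)) (c := c) ht hμ hc (by
    intro s hs
    exact hf (t - s) ⟨by linarith [hs.2], by linarith [hs.1]⟩)
  rw [intervalIntegral.integral_comp_sub_left (fun s => f s) t] at h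
  simpa using h

end Picard

/-! ### Operator-valued strong integrals -/

section StrongIntegral

variable {X Y : Type*} [NormedAddCommGroup X] [NormedSpace ℝ X] [CompleteSpace X]
  [NormedAddCommGroup Y] [NormedSpace ℝ Y] [CompleteSpace Y]

open Classical in
/-- The strong integral of an operator family. -/
noncomputable def strongIntegral (F : ℝ → X →L[ℝ] Y) (a b : ℝ) : X →L[ℝ] Y :=
  if h : ∃ L : X →L[ℝ] Y, ∀ x, L x = ∫ s in a..b, F s x then h.choose else 0

theorem strongIntegral_apply {F : ℝ → X →L[ℝ] Y} (hF : ∀ x, Continuous fun t => F t x) (a b : ℝ)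
    (x : X) : strongIntegral F a b x = ∫ s in a..b, F s x := by
  have h := exists_clm_eq_intervalIntegral hF a b
  rw [strongIntegral, dif_pos h]
  exact h.choose_spec x

end StrongIntegral

/-! ### The mild Lyapunov equation -/

section Lyapunov

variable {H : Type*} [NormedAddCommGroup H] [InnerProductSpace ℝ H] [CompleteSpace H]

/-- The mild solution operator of the backward Lyapunov equation
`D' + (A* - λ/2) D + D (A - λ/2) + h = 0`, `D(T) = G`, where `e t` stands for `e^{tA}`. -/
noncomputable def lyapunovMap (e : ℝ → H →L[ℝ] H) (T lam : ℝ) (G : H →L[ℝ] H)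
    (h : ℝ → H →L[ℝ] H) (t : ℝ) : H →L[ℝ] H :=
  Real.exp (-lam * (T - t)) • (ContinuousLinearMap.adjoint (e (T - t)) ∘L G ∘L e (T - t))
    + strongIntegral (fun s => Real.exp (-lam * (s - t)) •
        (ContinuousLinearMap.adjoint (e (s - t)) ∘L h s ∘L e (s - t))) t T

/-- A strongly continuous family of operators on the line whose adjoints are strongly continuous,
with the semigroup property on `[0, ∞)`. -/
structure IsSemigroupFamily (e : ℝ → H →L[ℝ] H) : Prop where
  cont : ∀ x, Continuous fun t => e t x
  cont_adj : ∀ x, Continuous fun t => ContinuousLinearMap.adjoint (e t) x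
  zero : ∀ x, e 0 x = x
  add : ∀ s t, 0 ≤ s → 0 ≤ t → ∀ x, e (s + t) x = e s (e t x)

variable {e : ℝ → H →L[ℝ] H} {T lam : ℝ} {G : H →L[ℝ] H} {h : ℝ → H →L[ℝ] H}

theorem IsSemigroupFamily.continuous_conj (he : IsSemigroupFamily e)
    (hh : ∀ x, Continuous fun t => h t x) (lam : ℝ) {α : Type*} [TopologicalSpace α]
    {τ σ : α → ℝ} (hτ : Continuous τ) (hσ : Continuous σ) (x : H) :
    Continuous fun a => Real.exp (-lam * τ a) •
      ContinuousLinearMap.adjoint (e (τ a)) (h (σ a) (e (τ a) x)) := by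
  refine Continuous.smul (by fun_prop) ?_
  exact continuous_clm_apply_of_strongly_continuous he.cont_adj hτ
    (continuous_clm_apply_of_strongly_continuous hh hσ ((he.cont x).comp hτ))

theorem IsSemigroupFamily.continuous_conj_sub (he : IsSemigroupFamily e)
    (hh : ∀ x, Continuous fun t => h t x) (lam t : ℝ) (x : H) :
    Continuous fun s => Real.exp (-lam * (s - t)) •
      ContinuousLinearMap.adjoint (e (s - t)) (h s (e (s - t) x)) :=
  he.continuous_conj hh lam (τ := fun s => s - t) (σ := fun s => s) (by fun_prop) (by fun_prop) x

theorem lyapunovMap_apply (he : IsSemigroupFamily e) (hh : ∀ x, Continuous fun t => h t x)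
    (t : ℝ) (x : H) :
    lyapunovMap e T lam G h t x
      = Real.exp (-lam * (T - t)) • ContinuousLinearMap.adjoint (e (T - t)) (G (e (T - t) x))
        + ∫ s in t..T, Real.exp (-lam * (s - t)) •
            ContinuousLinearMap.adjoint (e (s - t)) (h s (e (s - t) x)) := by
  rw [lyapunovMap, _root_.add_apply, strongIntegral_apply]
  · rfl
  · intro y
    exact he.continuous_conj_sub hh lam t y

theorem continuous_lyapunovMap (he : IsSemigroupFamily e) (hh : ∀ x, Continuous fun t => h t x)
    (x : H) : Continuous fun t => lyapunovMap e T lam G h t x := by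
  simp only [lyapunovMap_apply he hh]
  refine Continuous.add ?_ ?_
  · exact he.continuous_conj (h := fun _ => G) (fun _ => continuous_const) lam
      (continuous_const.sub continuous_id) continuous_id x
  · simp only [intervalIntegral.integral_symm T]
    refine Continuous.neg ?_
    exact intervalIntegral.continuous_parametric_intervalIntegral_of_continuous
      (f := fun t s => Real.exp (-lam * (s - t)) •
            ContinuousLinearMap.adjoint (e (s - t)) (h s (e (s - t) x)))
      (he.continuous_conj hh lam (continuous_snd.sub continuous_fst) continuous_snd x)
      continuous_id

theorem inner_lyapunovMap (he : IsSemigroupFamily e) (hh : ∀ x, Continuous fun t => h t x)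
    (t : ℝ) (x y : H) :
    inner ℝ (lyapunovMap e T lam G h t x) y
      = Real.exp (-lam * (T - t)) * inner ℝ (G (e (T - t) x)) (e (T - t) y)
        + ∫ s in t..T, Real.exp (-lam * (s - t)) * inner ℝ (h s (e (s - t) x)) (e (s - t) y) := by
  rw [lyapunovMap_apply he hh, inner_add_left, real_inner_smul_left,
    ContinuousLinearMap.adjoint_inner_left]
  congr 1
  have hc := he.continuous_conj_sub hh lam t x
  have := (innerSL ℝ y).intervalIntegral_comp_comm (hc.intervalIntegrable (μ := volume) t T)
  simp only [innerSL_apply_apply] at this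
  rw [real_inner_comm, ← this]
  refine intervalIntegral.integral_congr fun s _ => ?_
  rw [real_inner_comm, real_inner_smul_left, ContinuousLinearMap.adjoint_inner_left]

theorem continuous_inner_conj (he : IsSemigroupFamily e) (hh : ∀ x, Continuous fun t => h t x)
    (t : ℝ) (x y : H) : Continuous fun s =>
      Real.exp (-lam * (s - t)) * inner ℝ (h s (e (s - t) x)) (e (s - t) y) := by
  have h1 : Continuous fun s : ℝ => s - t := continuous_id.sub continuous_const
  refine Continuous.mul (by fun_prop) (Continuous.inner ?_ ((he.cont y).comp h1))
  exact continuous_clm_apply_of_strongly_continuous hh continuous_id ((he.cont x).comp h1)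

/-- Conjugation by `e`, nonnegative scalar weights and integration all preserve the order of
quadratic forms. This comparison provides the upper barrier for the Riccati iteration. -/
theorem inner_lyapunovMap_mono (he : IsSemigroupFamily e) (hh : ∀ x, Continuous fun t => h t x)
    {G' : H →L[ℝ] H} {h' : ℝ → H →L[ℝ] H} (hh' : ∀ x, Continuous fun t => h' t x) {t : ℝ}
    (ht : t ≤ T) (hG : ∀ x, inner ℝ (G x) x ≤ inner ℝ (G' x) x)
    (hle : ∀ s ∈ Icc t T, ∀ x, inner ℝ (h s x) x ≤ inner ℝ (h' s x) x) (x : H) :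
    inner ℝ (lyapunovMap e T lam G h t x) x ≤ inner ℝ (lyapunovMap e T lam G' h' t x) x := by
  rw [inner_lyapunovMap he hh, inner_lyapunovMap he hh']
  refine add_le_add ?_ ?_
  · exact mul_le_mul_of_nonneg_left (hG _) (Real.exp_nonneg _)
  · refine intervalIntegral.integral_mono_on ht
      ((continuous_inner_conj he hh t x x).intervalIntegrable _ _)
      ((continuous_inner_conj he hh' t x x).intervalIntegrable _ _) fun s hs => ?_
    exact mul_le_mul_of_nonneg_left (hle s hs _) (Real.exp_nonneg _)

theorem inner_lyapunovMap_nonneg (he : IsSemigroupFamily e) (hh : ∀ x, Continuous fun t => h t x)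
    {t : ℝ} (ht : t ≤ T) (hG : ∀ x, 0 ≤ inner ℝ (G x) x)
    (hpos : ∀ s ∈ Icc t T, ∀ x, 0 ≤ inner ℝ (h s x) x) (x : H) :
    0 ≤ inner ℝ (lyapunovMap e T lam G h t x) x := by
  rw [inner_lyapunovMap he hh]
  refine add_nonneg (mul_nonneg (Real.exp_nonneg _) (hG _)) ?_
  exact intervalIntegral.integral_nonneg ht fun s hs =>
    mul_nonneg (Real.exp_nonneg _) (hpos s hs _)

theorem inner_lyapunovMap_symm (he : IsSemigroupFamily e) (hh : ∀ x, Continuous fun t => h t x)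
    {t : ℝ} (ht : t ≤ T) (hG : ∀ x y, inner ℝ (G x) y = inner ℝ x (G y))
    (hs : ∀ s ∈ Icc t T, ∀ x y, inner ℝ (h s x) y = inner ℝ x (h s y)) (x y : H) :
    inner ℝ (lyapunovMap e T lam G h t x) y = inner ℝ x (lyapunovMap e T lam G h t y) := by
  rw [real_inner_comm _ x, inner_lyapunovMap he hh, inner_lyapunovMap he hh, hG, real_inner_comm]
  congr 1
  refine intervalIntegral.integral_congr fun s hs' => ?_
  rw [uIcc_of_le ht] at hs'
  rw [hs s hs', real_inner_comm]

theorem norm_lyapunovMap_sub_le (he : IsSemigroupFamily e) (hh : ∀ x, Continuous fun t => h t x)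
    {h' : ℝ → H →L[ℝ] H} (hh' : ∀ x, Continuous fun t => h' t x) {t M c μ : ℝ}
    (ht : t ∈ Icc 0 T) (hlam : 0 ≤ lam) (hM : ∀ s ∈ Icc 0 T, ‖e s‖ ≤ M) (hc : 0 ≤ c) (hμ : 0 < μ)
    (hle : ∀ s ∈ Icc t T, ‖h s - h' s‖ ≤ c * Real.exp (μ * (T - s))) :
    ‖lyapunovMap e T lam G h t - lyapunovMap e T lam G h' t‖
      ≤ M ^ 2 * c / μ * Real.exp (μ * (T - t)) := by
  have hM0 : 0 ≤ M := (norm_nonneg _).trans (hM t ht)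
  refine ContinuousLinearMap.opNorm_le_bound _ (by positivity) fun x => ?_
  rw [_root_.sub_apply, lyapunovMap_apply he hh, lyapunovMap_apply he hh',
    add_sub_add_left_eq_sub]
  rw [← intervalIntegral.integral_sub
    ((he.continuous_conj_sub hh lam t x).intervalIntegrable _ _)
    ((he.continuous_conj_sub hh' lam t x).intervalIntegrable _ _)]
  calc _ ≤ M ^ 2 * c * ‖x‖ / μ * Real.exp (μ * (T - t)) := by
        refine norm_integral_le_exp_backward ht.2 hμ (by positivity) fun s hs => ?_
        have hst : s - t ∈ Icc 0 T := ⟨by linarith [hs.1], by linarith [hs.2, ht.1]⟩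
        rw [← smul_sub, ← map_sub, ← _root_.sub_apply, norm_smul,
          Real.norm_of_nonneg (Real.exp_nonneg _)]
        have h1 : Real.exp (-lam * (s - t)) ≤ 1 := by
          rw [Real.exp_le_one_iff]; nlinarith [hst.1]
        calc _ ≤ 1 * (M * (c * Real.exp (μ * (T - s)) * (M * ‖x‖))) := by
              gcongr
              refine ContinuousLinearMap.le_of_opNorm_le_of_le _ ?_ ?_
              · rw [LinearIsometryEquiv.norm_map]; exact hM _ hst
              · exact ContinuousLinearMap.le_of_opNorm_le_of_le _ (hle s hs)
                  (ContinuousLinearMap.le_of_opNorm_le _ (hM _ hst) x)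
          _ = _ := by ring
    _ = _ := by ring

/-- A mild solution of the Lyapunov equation also solves the equation obtained by moving a multiple
of the unknown from the operator to the right-hand side. -/
theorem lyapunovMap_shift (he : IsSemigroupFamily e) (hh : ∀ x, Continuous fun t => h t x)
    (lam : ℝ) {t : ℝ} (ht : t ≤ T) :
    lyapunovMap e T lam G (fun s => h s + lam • lyapunovMap e T 0 G h s) t
      = lyapunovMap e T 0 G h t := by
  ext x
  have hD : ∀ x, Continuous fun t => lyapunovMap e T 0 G h t x := continuous_lyapunovMap he hh
  have hhD : ∀ x, Continuous fun s => (h s + lam • lyapunovMap e T 0 G h s) x := fun x =>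
    (hh x).add ((hD x).const_smul lam)
  have hk := he.continuous_conj_sub hh 0 t x
  simp only [neg_zero, zero_mul, Real.exp_zero, one_smul] at hk
  set k : ℝ → H := fun s => ContinuousLinearMap.adjoint (e (s - t)) (h s (e (s - t) x)) with hkdef
  set g := ContinuousLinearMap.adjoint (e (T - t)) (G (e (T - t) x)) with hg
  -- By the semigroup property, conjugating the solution at time `s` by `e (s - t)` leaves the tail
  -- from `s` of the formula for the solution at time `t`.
  have hWD : ∀ s ∈ Icc t T, ContinuousLinearMap.adjoint (e (s - t))
      (lyapunovMap e T 0 G h s (e (s - t) x)) = g + ∫ u in s..T, k u := by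
    intro s hs
    have hst : 0 ≤ s - t := by linarith [hs.1]
    have hadj : ∀ u, s ≤ u → ∀ y, ContinuousLinearMap.adjoint (e (s - t))
        (ContinuousLinearMap.adjoint (e (u - s)) y) = ContinuousLinearMap.adjoint (e (u - t)) y := by
      intro u hu y
      refine ext_inner_right ℝ fun w => ?_
      rw [ContinuousLinearMap.adjoint_inner_left, ContinuousLinearMap.adjoint_inner_left,
        ContinuousLinearMap.adjoint_inner_left, ← he.add _ _ (by linarith) hst]
      congr 3; ring
    have hadd : ∀ u, s ≤ u → e (u - s) (e (s - t) x) = e (u - t) x := by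
      intro u hu
      rw [← he.add _ _ (by linarith) hst]; congr 2; ring
    rw [lyapunovMap_apply he hh]
    simp only [neg_zero, zero_mul, Real.exp_zero, one_smul]
    rw [map_add, hadj T hs.2, hadd T hs.2]
    congr 1
    have hci := he.continuous_conj_sub hh 0 s (e (s - t) x)
    simp only [neg_zero, zero_mul, Real.exp_zero, one_smul] at hci
    rw [← ContinuousLinearMap.intervalIntegral_comp_comm _ (hci.intervalIntegrable _ _)]
    refine intervalIntegral.integral_congr fun u hu => ?_
    rw [uIcc_of_le hs.2] at hu
    simp only [hkdef]
    rw [hadj u hu.1, hadd u hu.1]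
  -- The discounted tail has minus the shifted integrand as derivative. Its value at `s = t` is the
  -- undiscounted solution, and its value at `s = T` cancels the discounted terminal term.
  set φ : ℝ → H := fun s => Real.exp (-lam * (s - t)) • (g + ∫ u in s..T, k u) with hφ
  set φ' : ℝ → H := fun s => -(Real.exp (-lam * (s - t)) • k s
    + (lam * Real.exp (-lam * (s - t))) • (g + ∫ u in s..T, k u)) with hφ'
  have hI : ∀ s, HasDerivAt (fun s => ∫ u in s..T, k u) (-k s) s := fun s =>
    intervalIntegral.integral_hasDerivAt_left (hk.intervalIntegrable _ _)
      (hk.stronglyMeasurableAtFilter _ _) hk.continuousAt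
  have hIc : Continuous fun s => ∫ u in s..T, k u :=
    continuous_iff_continuousAt.2 fun s => (hI s).continuousAt
  have hd : ∀ s ∈ uIcc t T, HasDerivAt φ (φ' s) s := by
    intro s _
    have h1 : HasDerivAt (fun s => Real.exp (-lam * (s - t)))
        (Real.exp (-lam * (s - t)) * (-lam * 1)) s :=
      (((hasDerivAt_id s).sub_const t).const_mul (-lam)).exp
    refine (h1.smul ((hI s).const_add g)).congr_deriv ?_
    simp only [hφ']
    module
  have hφ'c : Continuous φ' := by
    simp only [hφ']
    fun_prop
  have hFTC := intervalIntegral.integral_eq_sub_of_hasDerivAt hd (hφ'c.intervalIntegrable _ _)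
  have hint : (∫ s in t..T, Real.exp (-lam * (s - t)) • ContinuousLinearMap.adjoint (e (s - t))
      ((h s + lam • lyapunovMap e T 0 G h s) (e (s - t) x))) = -∫ s in t..T, φ' s := by
    rw [← intervalIntegral.integral_neg]
    refine intervalIntegral.integral_congr fun s hs => ?_
    rw [uIcc_of_le ht] at hs
    rw [hφ', neg_neg, _root_.add_apply, _root_.smul_apply, map_add, map_smul, hWD s hs, smul_add, smul_smul,
      mul_comm lam]
  rw [lyapunovMap_apply he hhD, lyapunovMap_apply he hh, hint, hFTC]
  simp [hφ, hkdef, hg]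

end Lyapunov

/-! ### The operator Riccati equation -/

section Riccati

variable {H : Type*} [NormedAddCommGroup H] [InnerProductSpace ℝ H]

/-- This is `F² ≤ v F` for `0 ≤ F ≤ v`, obtained without square roots by expanding the nonnegative
form at `v • x - F x` and using the upper bound at `F x`. -/
theorem norm_sq_le_of_inner_le {F : H →L[ℝ] H} {v : ℝ} (hv : 0 < v)
    (hsymm : ∀ x y, inner ℝ (F x) y = inner ℝ x (F y)) (hpos : ∀ x, 0 ≤ inner ℝ (F x) x)
    (hle : ∀ x, inner ℝ (F x) x ≤ v * ‖x‖ ^ 2) (x : H) :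
    ‖F x‖ ^ 2 ≤ v * inner ℝ (F x) x := by
  have h := hpos (v • x - F x)
  have h2 := hle (F x)
  have e : inner ℝ (F (v • x - F x)) (v • x - F x)
      = v ^ 2 * inner ℝ (F x) x - 2 * v * ‖F x‖ ^ 2 + inner ℝ (F (F x)) (F x) := by
    have h3 : inner ℝ (F (F x)) x = ‖F x‖ ^ 2 := by rw [hsymm, real_inner_self_eq_norm_sq]
    simp only [map_sub, map_smul, inner_sub_left, inner_sub_right, real_inner_smul_left,
      real_inner_smul_right, real_inner_self_eq_norm_sq, h3]
    ring
  rw [e] at h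
  have : v * (‖F x‖ ^ 2) ≤ v * (v * inner ℝ (F x) x) := by nlinarith
  exact le_of_mul_le_mul_left this hv

theorem norm_le_of_inner_le {F : H →L[ℝ] H} {v : ℝ} (hv : 0 < v)
    (hsymm : ∀ x y, inner ℝ (F x) y = inner ℝ x (F y)) (hpos : ∀ x, 0 ≤ inner ℝ (F x) x)
    (hle : ∀ x, inner ℝ (F x) x ≤ v * ‖x‖ ^ 2) : ‖F‖ ≤ v := by
  refine ContinuousLinearMap.opNorm_le_bound _ hv.le fun x => ?_
  have h := norm_sq_le_of_inner_le hv hsymm hpos hle x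
  refine le_of_sq_le_sq ?_ (by positivity)
  nlinarith [hle x]

theorem inner_clm_apply_le {F : H →L[ℝ] H} {v : ℝ} (hF : ‖F‖ ≤ v) (x : H) :
    inner ℝ (F x) x ≤ v * ‖x‖ ^ 2 := by
  calc _ ≤ ‖F x‖ * ‖x‖ := real_inner_le_norm _ _
    _ ≤ (v * ‖x‖) * ‖x‖ := by gcongr; exact F.le_of_opNorm_le hF x
    _ = _ := by ring

variable [CompleteSpace H]

/-- Existence of a nonnegative mild solution of the operator Riccati equation. -/
theorem exists_mild_riccati {e : ℝ → H →L[ℝ] H} (he : IsSemigroupFamily e) {T : ℝ} (hT : 0 ≤ T)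
    {G Q K : H →L[ℝ] H} (hG : G.IsPositive) (hQ : Q.IsPositive) (hK : K.IsPositive) :
    ∃ P : ℝ → H →L[ℝ] H, (∀ x, Continuous fun t => P t x) ∧
      (∀ t ∈ Icc 0 T, (P t).IsPositive) ∧
      ∀ t ∈ Icc 0 T, P t = lyapunovMap e T 0 G (fun s => Q - P s ∘L K ∘L P s) t := by
  have hGs : ∀ x y, inner ℝ (G x) y = inner ℝ x (G y) := hG.inner_left_eq_inner_right
  have hQs : ∀ x y, inner ℝ (Q x) y = inner ℝ x (Q y) := hQ.inner_left_eq_inner_right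
  have hKs : ∀ x y, inner ℝ (K x) y = inner ℝ x (K y) := hK.inner_left_eq_inner_right
  have hG0 : ∀ x, 0 ≤ inner ℝ (G x) x := hG.inner_nonneg_left
  have hQ0 : ∀ x, 0 ≤ inner ℝ (Q x) x := hQ.inner_nonneg_left
  have hK0 : ∀ x, 0 ≤ inner ℝ (K x) x := hK.inner_nonneg_left
  obtain ⟨M, hM0, hM⟩ := exists_norm_le_of_strongly_continuous he.cont 0 T
  have hQc : ∀ x, Continuous fun _ : ℝ => Q x := fun x => continuous_const
  -- The equation with the nonpositive term `-P K P` dropped gives the upper barrier.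
  set V : ℝ → H →L[ℝ] H := lyapunovMap e T 0 G (fun _ => Q) with hV
  have hVc : ∀ x, Continuous fun t => V t x := continuous_lyapunovMap he hQc
  obtain ⟨v, hv0, hv⟩ := exists_norm_le_of_strongly_continuous hVc 0 T
  have hV0 : ∀ t ∈ Icc 0 T, ∀ x, 0 ≤ inner ℝ (V t x) x := fun t ht =>
    inner_lyapunovMap_nonneg he hQc ht.2 hG0 fun _ _ => hQ0
  have hVs : ∀ t ∈ Icc 0 T, ∀ x y, inner ℝ (V t x) y = inner ℝ x (V t y) := fun t ht =>
    inner_lyapunovMap_symm he hQc ht.2 hGs fun _ _ => hQs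
  -- Chosen so that `F K F ≤ ‖K‖ F² ≤ lam F` for `0 ≤ F ≤ v`, which makes the shifted source `Q - F
  -- K F + lam F` nonnegative.
  set lam := ‖K‖ * v with hlam
  have hlam0 : 0 ≤ lam := by positivity
  set q : (ℝ → H →L[ℝ] H) → ℝ → H →L[ℝ] H := fun F s => Q - F s ∘L K ∘L F s with hq
  set hmap : (ℝ → H →L[ℝ] H) → ℝ → H →L[ℝ] H := fun F s => q F s + lam • F s with hhmap
  -- Clamping the time lets functions on the whole line serve as unknowns while their values come
  -- only from `[0, T]`.
  set clamp : ℝ → ℝ := fun t => max 0 (min t T) with hclamp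
  have hclampc : Continuous clamp := by fun_prop
  have hclamp_mem : ∀ t, clamp t ∈ Icc 0 T := fun t =>
    ⟨le_max_left _ _, max_le hT (min_le_right _ _)⟩
  have hclamp_eq : ∀ t ∈ Icc 0 T, clamp t = t := fun t ht => by
    simp [hclamp, min_eq_left ht.2, max_eq_right ht.1]
  set S : Set (ℝ → H →L[ℝ] H) := {F | (∀ x, Continuous fun t => F t x) ∧
    ∀ t, (∀ x y, inner ℝ (F t x) y = inner ℝ x (F t y)) ∧ ∀ x, 0 ≤ inner ℝ (F t x) x ∧
      inner ℝ (F t x) x ≤ inner ℝ (V (clamp t) x) x} with hS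
  have hSle : ∀ F ∈ S, ∀ t x, inner ℝ (F t x) x ≤ v * ‖x‖ ^ 2 := fun F hF t x =>
    ((hF.2 t).2 x).2.trans (inner_clm_apply_le (hv _ (hclamp_mem t)) x)
  have hSsq : ∀ F ∈ S, ∀ t x, ‖F t x‖ ^ 2 ≤ v * inner ℝ (F t x) x := fun F hF t =>
    norm_sq_le_of_inner_le hv0 (hF.2 t).1 (fun x => ((hF.2 t).2 x).1) (hSle F hF t)
  have hSnorm : ∀ F ∈ S, ∀ t, ‖F t‖ ≤ v := fun F hF t =>
    norm_le_of_inner_le hv0 (hF.2 t).1 (fun x => ((hF.2 t).2 x).1) (hSle F hF t)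
  have hqc : ∀ F ∈ S, ∀ x, Continuous fun t => q F t x := fun F hF x =>
    continuous_const.sub (continuous_clm_apply_of_strongly_continuous hF.1 continuous_id
      (K.continuous.comp (hF.1 x)))
  have hhc : ∀ F ∈ S, ∀ x, Continuous fun t => hmap F t x := fun F hF x =>
    (hqc F hF x).add ((hF.1 x).const_smul lam)
  have hhs : ∀ F ∈ S, ∀ t x y, inner ℝ (hmap F t x) y = inner ℝ x (hmap F t y) := by
    intro F hF t x y
    have h1 := (hF.2 t).1
    simp only [hhmap, hq, _root_.add_apply, _root_.sub_apply, _root_.smul_apply,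
      ContinuousLinearMap.comp_apply, inner_add_left, inner_sub_left, inner_add_right,
      inner_sub_right, real_inner_smul_left, real_inner_smul_right, h1, hKs, hQs]
  have hinner : ∀ F ∈ S, ∀ t x, inner ℝ (hmap F t x) x
      = inner ℝ (Q x) x - inner ℝ (K (F t x)) (F t x) + lam * inner ℝ (F t x) x := by
    intro F hF t x
    simp only [hhmap, hq, _root_.add_apply, _root_.sub_apply, _root_.smul_apply,
      ContinuousLinearMap.comp_apply, inner_add_left, inner_sub_left, real_inner_smul_left,
      (hF.2 t).1 (K (F t x)) x]
  have hh0 : ∀ F ∈ S, ∀ t x, 0 ≤ inner ℝ (hmap F t x) x := by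
    intro F hF t x
    rw [hinner F hF]
    have h1 : inner ℝ (K (F t x)) (F t x) ≤ ‖K‖ * ‖F t x‖ ^ 2 := inner_clm_apply_le le_rfl _
    have h2 : ‖K‖ * ‖F t x‖ ^ 2 ≤ ‖K‖ * (v * inner ℝ (F t x) x) := by
      gcongr
      exact hSsq F hF t x
    have h3 := hQ0 x
    rw [← mul_assoc] at h2
    linarith
  set Ψ : (ℝ → H →L[ℝ] H) → ℝ → H →L[ℝ] H := fun F t =>
    lyapunovMap e T lam G (hmap F) (clamp t) with hΨ
  have hΨS : ∀ F ∈ S, Ψ F ∈ S := by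
    intro F hF
    refine ⟨fun x => (continuous_lyapunovMap he (hhc F hF) x).comp hclampc, fun t =>
      ⟨inner_lyapunovMap_symm he (hhc F hF) (hclamp_mem t).2 hGs fun s _ => hhs F hF s,
        fun x => ⟨inner_lyapunovMap_nonneg he (hhc F hF) (hclamp_mem t).2 hG0
          (fun s _ => hh0 F hF s) x, ?_⟩⟩⟩
    -- The source of any `F` below `V` is at most `Q + lam V`. With that source the discounted
    -- equation reproduces `V`, so the barrier is preserved.
    have hc' : ∀ x, Continuous fun s => (Q + lam • V s) x := fun x =>
      (hQc x).add ((hVc x).const_smul lam)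
    have h1 := inner_lyapunovMap_mono (G := G) (G' := G) (lam := lam) he (hhc F hF) hc'
      (hclamp_mem t).2 (fun _ => le_rfl) (fun s hs x => by
        have hs' : s ∈ Icc 0 T := ⟨(hclamp_mem t).1.trans hs.1, hs.2⟩
        have h2 := ((hF.2 s).2 x).2
        rw [hclamp_eq s hs'] at h2
        rw [hinner F hF, _root_.add_apply, _root_.smul_apply, inner_add_left,
          real_inner_smul_left]
        have h3 := hK0 (F s x)
        have h4 := mul_le_mul_of_nonneg_left h2 hlam0
        linarith) x
    rwa [lyapunovMap_shift (h := fun _ => Q) he hQc lam (hclamp_mem t).2] at h1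
  set L := lam + 2 * v * ‖K‖ with hL
  have hL0 : 0 ≤ L := by positivity
  -- `M ^ 2 * L` is the Lipschitz constant before the gain `1/μ`, so the contraction factor is at
  -- most `1/2`. The `1` keeps `μ` positive.
  set μ := 2 * (M ^ 2 * L) + 1 with hμ
  have hμ0 : 0 < μ := by positivity
  have hμL : ∀ c, 0 ≤ c → M ^ 2 * (L * c) / μ ≤ c / 2 := fun c hc => by
    rw [div_le_div_iff₀ hμ0 two_pos]
    nlinarith [mul_nonneg (mul_nonneg (sq_nonneg M) hL0) hc]
  set w : ℝ → ℝ := fun t => Real.exp (μ * (T - clamp t)) with hw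
  have hlip : ∀ F ∈ S, ∀ F' ∈ S, ∀ t, ‖hmap F t - hmap F' t‖ ≤ L * ‖F t - F' t‖ := by
    intro F hF F' hF' t
    have hid : hmap F t - hmap F' t = lam • (F t - F' t)
        - ((F t - F' t) ∘L K ∘L F t + F' t ∘L K ∘L (F t - F' t)) := by
      ext x
      simp only [hhmap, hq, _root_.add_apply, _root_.sub_apply, _root_.smul_apply,
        ContinuousLinearMap.comp_apply, map_sub]
      module
    rw [hid]
    have hb1 : ‖(F t - F' t) ∘L K ∘L F t‖ ≤ ‖F t - F' t‖ * (‖K‖ * v) := by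
      refine (ContinuousLinearMap.opNorm_comp_le _ _).trans ?_
      gcongr
      refine (ContinuousLinearMap.opNorm_comp_le _ _).trans ?_
      gcongr
      exact hSnorm F hF t
    have hb2 : ‖F' t ∘L K ∘L (F t - F' t)‖ ≤ v * (‖K‖ * ‖F t - F' t‖) := by
      refine (ContinuousLinearMap.opNorm_comp_le _ _).trans ?_
      gcongr
      · exact hSnorm F' hF' t
      · exact ContinuousLinearMap.opNorm_comp_le _ _
    calc _ ≤ ‖lam • (F t - F' t)‖
          + (‖(F t - F' t) ∘L K ∘L F t‖ + ‖F' t ∘L K ∘L (F t - F' t)‖) :=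
        (norm_sub_le _ _).trans (add_le_add le_rfl (norm_add_le _ _))
      _ ≤ lam * ‖F t - F' t‖ + (‖F t - F' t‖ * (‖K‖ * v) + v * (‖K‖ * ‖F t - F' t‖)) := by
        rw [norm_smul, Real.norm_of_nonneg hlam0]
        gcongr
      _ = _ := by rw [hL]; ring
  have hVS : (fun t => V (clamp t)) ∈ S :=
    ⟨fun x => (hVc x).comp hclampc, fun t => ⟨hVs _ (hclamp_mem t), fun x =>
      ⟨hV0 _ (hclamp_mem t) x, le_rfl⟩⟩⟩
  obtain ⟨P, hPS, hPfix⟩ := exists_fixedPoint_of_weighted_contraction (S := S) (Ψ := Ψ) (w := w)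
    (W := Real.exp (μ * T)) (F₀ := fun t => V (clamp t)) (c₀ := 2 * v)
    (fun t => by
      simp only [hw]
      gcongr
      linarith [(hclamp_mem t).1]) hΨS
    (fun F hF F' hF' c hc hle t => by
      have h1 := norm_lyapunovMap_sub_le (lam := lam) (G := G) he (hhc F hF) (hhc F' hF')
        (hclamp_mem t) hlam0 hM (c := L * c) (by positivity) hμ0 (fun s hs => by
          have hs' : s ∈ Icc 0 T := ⟨(hclamp_mem t).1.trans hs.1, hs.2⟩
          have h2 := hle s
          simp only [hw, hclamp_eq s hs'] at h2
          calc _ ≤ L * ‖F s - F' s‖ := hlip F hF F' hF' s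
            _ ≤ L * (c * Real.exp (μ * (T - s))) := by gcongr
            _ = _ := by ring)
      exact h1.trans (mul_le_mul_of_nonneg_right (hμL c hc) (Real.exp_nonneg _)))
    hVS (by positivity)
    (fun t => by
      have h1 : 1 ≤ w t := by
        simp only [hw]
        rw [Real.one_le_exp_iff]
        have := (hclamp_mem t).2
        exact mul_nonneg hμ0.le (by linarith)
      calc _ ≤ ‖V (clamp t)‖ + ‖Ψ (fun t => V (clamp t)) t‖ := norm_sub_le _ _
        _ ≤ v + v := add_le_add (hSnorm _ hVS t) (hSnorm _ (hΨS _ hVS) t)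
        _ = 2 * v * 1 := by ring
        _ ≤ _ := by gcongr)
    (fun u hu F hF => by
      have hpt : ∀ t x, Tendsto (fun k => u k t x) atTop (𝓝 (F t x)) := fun t x =>
        ((ContinuousLinearMap.apply ℝ H x).continuous.tendsto (F t)).comp (hF.tendsto_at t)
      refine ⟨fun x => ?_, fun t => ⟨fun x y => ?_, fun x => ⟨?_, ?_⟩⟩⟩
      · have : TendstoUniformly (fun k t => u k t x) (fun t => F t x) atTop :=
          (ContinuousLinearMap.apply ℝ H x).uniformContinuous.comp_tendstoUniformly hF
        exact this.continuous (Frequently.of_forall fun k => (hu k).1 x)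
      · refine tendsto_nhds_unique ((hpt t x).inner (tendsto_const_nhds (x := y))) ?_
        refine ((tendsto_const_nhds (x := x)).inner (hpt t y)).congr fun k => ?_
        exact (((hu k).2 t).1 x y).symm
      · exact ge_of_tendsto' ((hpt t x).inner tendsto_const_nhds)
          fun k => (((hu k).2 t).2 x).1
      · exact le_of_tendsto' ((hpt t x).inner tendsto_const_nhds)
          fun k => (((hu k).2 t).2 x).2)
  refine ⟨P, hPS.1, fun t _ => ?_, ?_⟩
  · rw [ContinuousLinearMap.isPositive_iff]
    refine ⟨fun x y => (hPS.2 t).1 x y, fun x => ((hPS.2 t).2 x).1⟩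
  have hPeq : ∀ t ∈ Icc 0 T, P t = lyapunovMap e T lam G (hmap P) t := fun t ht => by
    conv_lhs => rw [← hPfix]
    simp only [hΨ, hclamp_eq t ht]
  -- To remove the discount, `D` is the undiscounted solution with the source frozen at `q P`. By
  -- the shift lemma, `P` and `D` are both fixed points of the affine map with source `q P + lam •`
  -- unknown, and iterating the weighted estimate forces `P = D` on `[0, T]`.
  set D := lyapunovMap e T 0 G (q P) with hD
  have hDc : ∀ x, Continuous fun t => D t x := continuous_lyapunovMap he (hqc P hPS)
  obtain ⟨d, hd0, hd⟩ := exists_norm_le_of_strongly_continuous hDc 0 T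
  have hDeq : ∀ t ∈ Icc 0 T, lyapunovMap e T lam G (fun s => q P s + lam • D s) t = D t :=
    fun t ht => lyapunovMap_shift he (hqc P hPS) lam ht.2
  have hiter : ∀ k : ℕ, ∀ t ∈ Icc 0 T, ‖P t - D t‖ ≤ (v + d) / 2 ^ k * Real.exp (μ * (T - t)) := by
    intro k
    induction k with
    | zero =>
      intro t ht
      have h1 : 1 ≤ Real.exp (μ * (T - t)) := by
        rw [Real.one_le_exp_iff]
        exact mul_nonneg hμ0.le (by linarith [ht.2])
      calc _ ≤ ‖P t‖ + ‖D t‖ := norm_sub_le _ _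
        _ ≤ v + d := add_le_add (hSnorm _ hPS t) (hd t ht)
        _ ≤ (v + d) / 2 ^ 0 * Real.exp (μ * (T - t)) := by
          rw [pow_zero, div_one]
          exact le_mul_of_one_le_right (by positivity) h1
    | succ k ih =>
      intro t ht
      rw [hPeq t ht, ← hDeq t ht]
      have h1 := norm_lyapunovMap_sub_le (lam := lam) (G := G) he (hhc P hPS)
        (h' := fun s => q P s + lam • D s) (fun x => (hqc P hPS x).add ((hDc x).const_smul lam))
        ht hlam0 hM (c := L * ((v + d) / 2 ^ k)) (by positivity) hμ0 (fun s hs => by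
          have hs' : s ∈ Icc 0 T := ⟨ht.1.trans hs.1, hs.2⟩
          simp only [hhmap, add_sub_add_left_eq_sub, ← smul_sub]
          rw [norm_smul, Real.norm_of_nonneg hlam0]
          calc _ ≤ L * ((v + d) / 2 ^ k * Real.exp (μ * (T - s))) := by
                refine mul_le_mul ?_ (ih s hs') (norm_nonneg _) hL0
                rw [hL]
                have : 0 ≤ 2 * v * ‖K‖ := by positivity
                linarith
            _ = _ := by ring)
      refine h1.trans (mul_le_mul_of_nonneg_right ?_ (Real.exp_nonneg _))
      refine (hμL _ (by positivity)).trans (le_of_eq ?_)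
      rw [pow_succ]; ring
  intro t ht
  have hlim : Tendsto (fun k : ℕ => (v + d) / 2 ^ k * Real.exp (μ * (T - t))) atTop (𝓝 0) := by
    have h1 : Tendsto (fun k : ℕ => (v + d) / (2 : ℝ) ^ k) atTop (𝓝 0) :=
      (tendsto_pow_atTop_atTop_of_one_lt (by norm_num)).const_div_atTop _
    simpa using h1.mul_const (Real.exp (μ * (T - t)))
  have h0 := ge_of_tendsto' hlim fun k => hiter k t ht
  exact sub_eq_zero.1 (norm_le_zero_iff.1 h0)

end Riccati

/-! ### The Riccati equation of the game -/

section Coefficients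

variable {H K U : Type*}
  [NormedAddCommGroup H] [InnerProductSpace ℝ H] [CompleteSpace H]
  [NormedAddCommGroup K] [InnerProductSpace ℝ K]
  [NormedAddCommGroup U] [InnerProductSpace ℝ U] [CompleteSpace U]

theorem Coefficients.Standing.isSemigroupFamily {D : Coefficients H K U} (hD : D.Standing) :
    IsSemigroupFamily fun t => D.expA (max t 0) where
  cont := hD.semigroup.continuous_max
  cont_adj := (hD.semigroup.adjoint hD.generator).continuous_max
  zero x := by simp [hD.semigroup.apply_zero]
  add s t hs ht x := by
    rw [max_eq_left hs, max_eq_left ht, max_eq_left (by positivity), hD.semigroup.apply_add hs ht]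

/-- If `R` is invertible, positivity follows by writing vectors as `R y`. Otherwise `inverse` takes
its default value `0`, which is also positive, so invertibility need not be established here. -/
theorem Coefficients.Standing.isPositive_inverse {D : Coefficients H K U} (hD : D.Standing) :
    D.R.inverse.IsPositive := by
  obtain ⟨ε, hε, hR⟩ := hD.R_coercive
  by_cases hinv : D.R.IsInvertible
  · obtain ⟨f, hf⟩ := hinv
    rw [← hf, ContinuousLinearMap.inverse_equiv, ContinuousLinearMap.isPositive_iff]
    have hsymm : ∀ x y, inner ℝ (f x) y = inner ℝ x (f y) := fun x y => by
      have := hD.R_selfAdjoint.isSymmetric x y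
      rw [← hf] at this
      exact this
    refine ⟨fun x y => ?_, fun x => ?_⟩
    · have := hsymm (f.symm x) (f.symm y)
      simpa using this.symm
    · have := hR (f.symm x)
      rw [← hf] at this
      simp only [ContinuousLinearEquiv.coe_coe, ContinuousLinearEquiv.apply_symm_apply] at this
      rw [ContinuousLinearEquiv.coe_coe, real_inner_comm]
      exact le_trans (by positivity) this
  · rw [ContinuousLinearMap.inverse_of_not_isInvertible hinv]
    exact ContinuousLinearMap.isPositive_zero

theorem Coefficients.Standing.isPositive_BRB {D : Coefficients H K U} (hD : D.Standing) :
    D.BRB.IsPositive :=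
  hD.isPositive_inverse.conj_adjoint D.B

/-- Existence of a mild solution of the Riccati equation of the mean field game. -/
theorem Coefficients.Standing.exists_isMildRiccati {D : Coefficients H K U} (hD : D.Standing)
    {T : ℝ} (hT : 0 ≤ T) :
    ∃ P : ℝ → H →L[ℝ] H, (∀ x, Continuous fun t => P t x) ∧ D.IsMildRiccati T P := by
  have he := hD.isSemigroupFamily
  obtain ⟨P, hPc, hPpos, hP⟩ := exists_mild_riccati he hT hD.QT_add_QbarT_pos hD.Q_add_Qbar_pos
    hD.isPositive_BRB
  refine ⟨P, hPc, ⟨hPpos, fun x => (hPc x).continuousOn⟩, fun x t ht => ?_⟩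
  have hPKPc : ∀ x, Continuous fun s => (P s ∘L D.BRB ∘L P s) x := fun x =>
    continuous_clm_apply_of_strongly_continuous hPc continuous_id (D.BRB.continuous.comp (hPc x))
  have hQc : ∀ x, Continuous fun _ : ℝ => (D.Q + D.Qbar) x := fun x => continuous_const
  have h1 := lyapunovMap_apply (T := T) (lam := 0) (G := D.QT + D.QbarT)
    (h := fun s => D.Q + D.Qbar - P s ∘L D.BRB ∘L P s) he (fun x => (hQc x).sub (hPKPc x)) t x
  rw [← hP t ht] at h1
  rw [h1]
  have c1 := he.continuous_conj_sub hQc 0 t x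
  have c2 := he.continuous_conj_sub hPKPc 0 t x
  simp only [neg_zero, zero_mul, Real.exp_zero, one_smul, _root_.sub_apply, map_sub] at c1 c2 ⊢
  rw [intervalIntegral.integral_sub (c1.intervalIntegrable _ _) (c2.intervalIntegrable _ _),
    add_sub_assoc]
  have hTt : max (T - t) 0 = T - t := max_eq_left (by linarith [ht.2])
  have hst : ∀ s ∈ uIcc t T, max (s - t) 0 = s - t := fun s hs => by
    rw [uIcc_of_le ht.2] at hs
    exact max_eq_left (by linarith [hs.1])
  congr 1
  · simp only [hTt]; rfl
  · congr 1 <;> refine intervalIntegral.integral_congr fun s hs => ?_ <;>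
      simp only [hst s hs] <;> rfl

end Coefficients

/-! ### Linear evolution equations with a bounded generator -/

section LinearODE

variable {H : Type*} [NormedAddCommGroup H] [NormedSpace ℝ H]

/-- An integral form of Grönwall's inequality. -/
theorem norm_le_of_norm_le_add_integral {T b k : ℝ} {z : ℝ → H} (hz : ContinuousOn z (Icc 0 T))
    (hb : 0 ≤ b) (hk : 0 < k)
    {g : ℝ → ℝ → H} (hg : ∀ t ∈ Icc 0 T, ∀ s ∈ Icc 0 t, ‖g t s‖ ≤ k * ‖z s‖)
    (hle : ∀ t ∈ Icc 0 T, ‖z t‖ ≤ b + ‖∫ s in (0 : ℝ)..t, g t s‖) :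
    ∀ t ∈ Icc 0 T, ‖z t‖ ≤ 2 * b * Real.exp (2 * k * T) := by
  intro t ht
  have hTne : (Icc 0 T).Nonempty := ⟨t, ht⟩
  have hcont : ContinuousOn (fun s => ‖z s‖ * Real.exp (-(2 * k * s))) (Icc 0 T) :=
    hz.norm.mul (by fun_prop)
  -- At a maximum point of the weighted norm, the weight rate `2 * k` lets the integral absorb at
  -- most half of the maximum: `m ≤ b + m / 2`, whence the factor `2 * b`.
  obtain ⟨t₁, ht₁, hmax⟩ := isCompact_Icc.exists_isMaxOn hTne hcont
  set m := ‖z t₁‖ * Real.exp (-(2 * k * t₁)) with hm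
  have hm0 : 0 ≤ m := by positivity
  have hexp : ∀ s, Real.exp (-(2 * k * s)) * Real.exp (2 * k * s) = 1 := fun s => by
    rw [← Real.exp_add]; simp
  have hzm : ∀ s ∈ Icc 0 T, ‖z s‖ ≤ m * Real.exp (2 * k * s) := fun s hs => by
    calc ‖z s‖ = ‖z s‖ * Real.exp (-(2 * k * s)) * Real.exp (2 * k * s) := by
          rw [mul_assoc, hexp, mul_one]
      _ ≤ _ := by
          gcongr
          exact hmax hs
  have h1 : ‖∫ s in (0 : ℝ)..t₁, g t₁ s‖ ≤ k * m / (2 * k) * Real.exp (2 * k * t₁) :=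
    norm_integral_le_exp_forward ht₁.1 (by positivity) (by positivity) fun s hs => by
      calc _ ≤ k * ‖z s‖ := hg t₁ ht₁ s hs
        _ ≤ k * (m * Real.exp (2 * k * s)) := by
          gcongr
          exact hzm s ⟨hs.1, hs.2.trans ht₁.2⟩
        _ = _ := by ring
  have h2 : k * m / (2 * k) = m / 2 := by field_simp
  rw [h2] at h1
  have h3 : m ≤ b + m / 2 := by
    calc m ≤ (b + m / 2 * Real.exp (2 * k * t₁)) * Real.exp (-(2 * k * t₁)) := by
          rw [hm]
          gcongr
          exact (hle t₁ ht₁).trans (add_le_add le_rfl h1)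
      _ = b * Real.exp (-(2 * k * t₁)) + m / 2 * (Real.exp (-(2 * k * t₁)) *
          Real.exp (2 * k * t₁)) := by ring
      _ ≤ b * 1 + m / 2 * 1 := by
          rw [hexp]
          gcongr
          rw [Real.exp_le_one_iff]
          have := ht₁.1
          have : 0 ≤ 2 * k * t₁ := by positivity
          linarith
      _ = _ := by ring
  calc ‖z t‖ ≤ m * Real.exp (2 * k * t) := hzm t ht
    _ ≤ (2 * b) * Real.exp (2 * k * T) := by
        gcongr
        · linarith
        · exact ht.2

variable [CompleteSpace H]

/-- Linear differential equations with strongly continuous bounded coefficients are solvable. -/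
theorem exists_linear_ode_solution {a : ℝ → H →L[ℝ] H} (ha : ∀ x, Continuous fun t => a t x)
    {T : ℝ} (hT : 0 ≤ T) (z₀ : H) :
    ∃ z : ℝ → H, Continuous z ∧ z 0 = z₀ ∧
      ∀ t ∈ Icc 0 T, HasDerivWithinAt z (a t (z t)) (Icc 0 T) t := by
  obtain ⟨M, hM0, hM⟩ := exists_norm_le_of_strongly_continuous ha 0 T
  set clamp : ℝ → ℝ := fun t => max 0 (min t T) with hclamp
  have hclampc : Continuous clamp := by fun_prop
  have hclamp_mem : ∀ t, clamp t ∈ Icc 0 T := fun t =>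
    ⟨le_max_left _ _, max_le hT (min_le_right _ _)⟩
  have hclamp_eq : ∀ t ∈ Icc 0 T, clamp t = t := fun t ht => by
    simp [hclamp, min_eq_left ht.2, max_eq_right ht.1]
  have hac : ∀ {z : ℝ → H}, Continuous z → Continuous fun s => a s (z s) := fun hz =>
    continuous_clm_apply_of_strongly_continuous ha continuous_id hz
  have hderiv : ∀ {z : ℝ → H}, Continuous z → ∀ t,
      HasDerivAt (fun t => z₀ + ∫ s in (0 : ℝ)..t, a s (z s)) (a t (z t)) t := fun hz t =>
    (intervalIntegral.integral_hasDerivAt_right ((hac hz).intervalIntegrable _ _)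
      ((hac hz).stronglyMeasurableAtFilter _ _) (hac hz).continuousAt).const_add z₀
  set Ψ : (ℝ → H) → ℝ → H := fun z t => z₀ + ∫ s in (0 : ℝ)..clamp t, a s (z s) with hΨ
  have hΨc : ∀ z, Continuous z → Continuous (Ψ z) := fun z hz =>
    (continuous_iff_continuousAt.2 fun t => (hderiv hz t).continuousAt).comp hclampc
  set μ := 2 * M with hμ
  have hμ0 : 0 < μ := by positivity
  set w : ℝ → ℝ := fun t => Real.exp (μ * clamp t) with hw
  have hw1 : ∀ t, 1 ≤ w t := fun t => by
    simp only [hw, Real.one_le_exp_iff]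
    exact mul_nonneg hμ0.le (hclamp_mem t).1
  obtain ⟨z, hz, hfix⟩ := exists_fixedPoint_of_weighted_contraction (S := {z | Continuous z})
    (Ψ := Ψ) (w := w) (W := Real.exp (μ * T)) (F₀ := fun _ => z₀) (c₀ := T * (M * ‖z₀‖))
    (fun t => by
      simp only [hw]
      gcongr
      exact (hclamp_mem t).2)
    hΨc
    (fun z hz z' hz' c hc hle t => by
      simp only [hΨ, add_sub_add_left_eq_sub]
      rw [← intervalIntegral.integral_sub ((hac hz).intervalIntegrable _ _)
        ((hac hz').intervalIntegrable _ _)]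
      have h1 := norm_integral_le_exp_forward (f := fun s => a s (z s) - a s (z' s)) (c := M * c)
        (hclamp_mem t).1 hμ0 (by positivity) (fun s hs => by
          have hs' : s ∈ Icc 0 T := ⟨hs.1, hs.2.trans (hclamp_mem t).2⟩
          have h2 := hle s
          simp only [hw, hclamp_eq s hs'] at h2
          rw [← map_sub, mul_assoc]
          exact ContinuousLinearMap.le_of_opNorm_le_of_le _ (hM s hs') h2)
      refine h1.trans (le_of_eq ?_)
      simp only [hw, hμ]
      field_simp)
    continuous_const (by positivity)
    (fun t => by
      simp only [hΨ, sub_add_cancel_left, norm_neg]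
      calc _ ≤ M * ‖z₀‖ * |clamp t - 0| :=
            intervalIntegral.norm_integral_le_of_norm_le_const fun s hs => by
              rw [uIoc_of_le (hclamp_mem t).1] at hs
              exact ContinuousLinearMap.le_of_opNorm_le _
                (hM s ⟨hs.1.le, hs.2.trans (hclamp_mem t).2⟩) _
        _ ≤ M * ‖z₀‖ * T := by
            rw [sub_zero, abs_of_nonneg (hclamp_mem t).1]
            gcongr
            exact (hclamp_mem t).2
        _ = T * (M * ‖z₀‖) * 1 := by ring
        _ ≤ _ := by gcongr; exact hw1 t)
    (fun u hu F hF => hF.continuous (Frequently.of_forall hu))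
  have hz' : ∀ t ∈ Icc 0 T, z t = z₀ + ∫ s in (0 : ℝ)..t, a s (z s) := fun t ht => by
    conv_lhs => rw [← hfix]
    simp only [hΨ, hclamp_eq t ht]
  refine ⟨z, hz, by simpa using hz' 0 ⟨le_rfl, hT⟩, fun t ht => ?_⟩
  exact (hderiv hz t).hasDerivWithinAt.congr hz' (hz' t ht)

/-- Variation of constants for a bounded generator. -/
theorem exp_apply_sub_eq_integral {B : H →L[ℝ] H} {T : ℝ} {z v : ℝ → H} (hv : Continuous v)
    (hz : ∀ t ∈ Icc 0 T, HasDerivWithinAt z (B (z t) + v t) (Icc 0 T) t) {p q : ℝ} (hp : 0 ≤ p)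
    (hpq : p ≤ q) (hq : q ≤ T) (t : ℝ) :
    ∫ s in p..q, NormedSpace.exp ((t - s) • B) (v s)
      = NormedSpace.exp ((t - q) • B) (z q) - NormedSpace.exp ((t - p) • B) (z p) := by
  have hexp : ∀ s, HasDerivAt (fun s => NormedSpace.exp ((t - s) • B))
      (-(NormedSpace.exp ((t - s) • B) * B)) s := fun s =>
    (hasDerivAt_exp_smul_const B (t - s)).comp_const_sub t s
  -- The time `t` is independent of the interval: `t = q` gives the forward formula and `t = p` the
  -- backward one.
  have hd : ∀ s ∈ Icc p q, HasDerivWithinAt (fun s => NormedSpace.exp ((t - s) • B) (z s))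
      (NormedSpace.exp ((t - s) • B) (v s)) (Icc p q) s := by
    intro s hs
    have h1 := (hexp s).hasDerivWithinAt.clm_apply
      ((hz s ⟨hp.trans hs.1, hs.2.trans hq⟩).mono (Icc_subset_Icc hp hq))
    refine h1.congr_deriv ?_
    rw [map_add, _root_.neg_apply, mul_apply_eq_comp]
    abel
  have hexpc : Continuous fun s => NormedSpace.exp ((t - s) • B) :=
    continuous_iff_continuousAt.2 fun s => (hexp s).continuousAt
  refine intervalIntegral.integral_eq_sub_of_hasDeriv_right_of_le hpq
    (fun s hs => (hd s hs).continuousWithinAt) (fun s hs => ?_)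
    ((hexpc.clm_apply hv).intervalIntegrable _ _)
  have h2 := (hd s ⟨hs.1.le, hs.2.le⟩).hasDerivAt (Icc_mem_nhds hs.1 hs.2)
  exact h2.hasDerivWithinAt

/-- Product rule for a strongly differentiable operator family applied to a curve. -/
theorem hasDerivWithinAt_strongly_clm_apply {F : ℝ → H →L[ℝ] H}
    (hF : ∀ x, Continuous fun t => F t x) {z : ℝ → H} {s : Set ℝ} {t : ℝ} {w z' : H}
    (hw : HasDerivWithinAt (fun u => F u (z t)) w s t) (hz : HasDerivWithinAt z z' s t) :
    HasDerivWithinAt (fun u => F u (z u)) (w + F t z') s t := by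
  rw [hasDerivWithinAt_iff_tendsto_slope] at *
  -- `F` is differentiable only on frozen vectors. The remaining part of the slope is `F u` applied
  -- to the slope of `z`, where joint continuity suffices.
  have h1 : Tendsto (fun u => F u (slope z t u)) (𝓝[s \ {t}] t) (𝓝 (F t z')) := by
    have h2 : Tendsto (fun u => (u, slope z t u)) (𝓝[s \ {t}] t) (𝓝 (t, z')) :=
      (tendsto_id.mono_left nhdsWithin_le_nhds).prodMk_nhds hz
    exact ((continuous_uncurry_of_strongly_continuous hF).tendsto (t, z')).comp h2
  refine (hw.add h1).congr fun u => ?_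
  simp only [slope_def_module, map_smul, map_sub, ← smul_add]
  congr 1
  abel

end LinearODE

/-! ### Decoupling the approximate forward-backward system -/

section Approximation

variable {H K U : Type*}
  [NormedAddCommGroup H] [InnerProductSpace ℝ H] [CompleteSpace H]
  [NormedAddCommGroup K] [InnerProductSpace ℝ K]
  [NormedAddCommGroup U] [InnerProductSpace ℝ U] [CompleteSpace U]

/-- The forward-backward system with a bounded operator in place of the generator is solved by
decoupling along a strict solution of the Riccati equation, with a bound on the solution that
depends only on the bounds of the data. -/
theorem Coefficients.IsStrictRiccati.exists_forwardBackward {D : Coefficients H K U} {T : ℝ}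
    (hT : 0 ≤ T) {P : ℝ → H →L[ℝ] H} (hP : ∀ x, Continuous fun t => P t x) {An : H →L[ℝ] H}
    {η : ℝ → H →L[ℝ] H} (hη : D.IsStrictRiccati T P An η) {C c p : ℝ}
    (hC : ∀ t ∈ Icc 0 T, ‖η t‖ ≤ C) (hc : 0 < c)
    (hAn : ∀ t ∈ Icc 0 T, ‖NormedSpace.exp (t • An)‖ ≤ c)
    (hp : ∀ t ∈ Icc 0 T, ‖P t‖ ≤ p) (z₀ : H) :
    ∃ z r : ℝ → H, Continuous z ∧ Continuous r ∧
      (∀ t ∈ Icc 0 T, ‖z t‖ ≤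
        2 * (c * ‖z₀‖) * Real.exp (2 * (c * (‖D.BRB‖ * (p + C)) + 1) * T)) ∧
      (∀ t ∈ Icc 0 T, ‖r t‖ ≤ C * ‖z t‖) ∧
      (∀ t ∈ Icc 0 T, z t = NormedSpace.exp (t • An) z₀
        - (∫ s in (0 : ℝ)..t, NormedSpace.exp ((t - s) • An) (D.BRB (P s (z s))))
        - ∫ s in (0 : ℝ)..t, NormedSpace.exp ((t - s) • An) (D.BRB (r s))) ∧
      ∀ t ∈ Icc 0 T, r t
        = ContinuousLinearMap.adjoint (NormedSpace.exp ((T - t) • An)) (-(D.QbarT (D.ST (z T))))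
        - (∫ s in t..T, ContinuousLinearMap.adjoint (NormedSpace.exp ((s - t) • An))
            (P s (D.BRB (r s))))
        - ∫ s in t..T, ContinuousLinearMap.adjoint (NormedSpace.exp ((s - t) • An))
            (D.Qbar (D.S (z s))) := by
  set clamp : ℝ → ℝ := fun t => max 0 (min t T) with hclamp
  have hclampc : Continuous clamp := by fun_prop
  have hclamp_mem : ∀ t, clamp t ∈ Icc 0 T := fun t =>
    ⟨le_max_left _ _, max_le hT (min_le_right _ _)⟩
  have hclamp_eq : ∀ t ∈ Icc 0 T, clamp t = t := fun t ht => by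
    simp [hclamp, min_eq_left ht.2, max_eq_right ht.1]
  set ζ : ℝ → H →L[ℝ] H := fun t => η (clamp t) with hζ
  have hηc : ∀ x, ContinuousOn (fun t => η t x) (Icc 0 T) := fun x t ht =>
    (hη.hasDeriv t ht x).continuousWithinAt
  have hζc : ∀ x, Continuous fun t => ζ t x := fun x =>
    (hηc x).comp_continuous hclampc hclamp_mem
  have hζη : ∀ t ∈ Icc 0 T, ζ t = η t := fun t ht => by simp only [hζ, hclamp_eq t ht]
  -- The closed loop: `r` is replaced by `η z` in the forward equation, which becomes an initial
  -- value problem for `z` alone.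
  obtain ⟨z, hzc, hz0, hz⟩ := exists_linear_ode_solution
    (a := fun t => An - D.BRB ∘L (P t + ζ t))
    (fun x => continuous_const.sub (D.BRB.continuous.comp ((hP x).add (hζc x)))) hT z₀
  set r : ℝ → H := fun t => ζ t (z t) with hr
  have hrc : Continuous r := continuous_clm_apply_of_strongly_continuous hζc continuous_id hzc
  have hPz : Continuous fun s => P s (z s) :=
    continuous_clm_apply_of_strongly_continuous hP continuous_id hzc
  have hPr : Continuous fun s => P s (D.BRB (r s)) :=
    continuous_clm_apply_of_strongly_continuous hP continuous_id (D.BRB.continuous.comp hrc)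
  have hz' : ∀ t ∈ Icc 0 T,
      HasDerivWithinAt z (An (z t) + -D.BRB (P t (z t) + r t)) (Icc 0 T) t := fun t ht =>
    (hz t ht).congr_deriv (by simp [hr]; abel)
  have hr' : ∀ t ∈ Icc 0 T, HasDerivWithinAt r
      ((-ContinuousLinearMap.adjoint An) (r t) + (P t (D.BRB (r t)) + D.Qbar (D.S (z t))))
      (Icc 0 T) t := by
    intro t ht
    have h1 : HasDerivWithinAt (fun u => ζ u (z t)) _ (Icc 0 T) t :=
      (hη.hasDeriv t ht (z t)).congr (fun u hu => by rw [hζη u hu]) (by rw [hζη t ht])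
    -- In the derivative of `η z`, the contribution of `z'` cancels the terms `η (A_n - B R⁻¹ B* P)
    -- z` and `η B R⁻¹ B* η z` of the Riccati equation, leaving the linear backward equation.
    refine (hasDerivWithinAt_strongly_clm_apply hζc h1 (hz' t ht)).congr_deriv ?_
    simp only [hr, hζη t ht, map_add, map_sub, map_neg, _root_.neg_apply]
    abel
  have hzeq : ∀ t ∈ Icc 0 T, z t = NormedSpace.exp (t • An) z₀
        - ∫ s in (0 : ℝ)..t, NormedSpace.exp ((t - s) • An) (D.BRB (P s (z s) + r s)) := by
    intro t ht
    have h1 := exp_apply_sub_eq_integral (v := fun s => -D.BRB (P s (z s) + r s))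
      (D.BRB.continuous.comp (hPz.add hrc)).neg hz' le_rfl ht.1 ht.2 t
    simp only [map_neg, intervalIntegral.integral_neg, sub_self,
      zero_smul, NormedSpace.exp_zero, sub_zero, one_apply_eq_self, hz0] at h1
    rw [sub_eq_add_neg, h1]
    abel
  have hexpadj : ∀ s : ℝ, NormedSpace.exp (s • ContinuousLinearMap.adjoint An)
      = ContinuousLinearMap.adjoint (NormedSpace.exp (s • An)) := fun s => by
    have h1 : ContinuousLinearMap.adjoint (s • An) = s • ContinuousLinearMap.adjoint An := by simp
    rw [← h1]
    exact (NormedSpace.star_exp (s • An)).symm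
  have hneg : ∀ a b : ℝ, (a - b) • (-ContinuousLinearMap.adjoint An)
      = (b - a) • ContinuousLinearMap.adjoint An := fun a b => by module
  have hexpc : Continuous fun s : ℝ => NormedSpace.exp (s • An) :=
    continuous_iff_continuousAt.2 fun s => (hasDerivAt_exp_smul_const An s).continuousAt
  refine ⟨z, r, hzc, hrc, ?_, fun t ht => ?_, fun t ht => ?_, fun t ht => ?_⟩
  -- Grönwall's lemma is applied with rate `c * (‖D.BRB‖ * (p + C)) + 1`; the `1` ensures the strict
  -- positivity it requires.
  · have hC0 : 0 ≤ C := (norm_nonneg _).trans (hC 0 ⟨le_rfl, hT⟩)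
    have hp0 : 0 ≤ p := (norm_nonneg _).trans (hp 0 ⟨le_rfl, hT⟩)
    refine norm_le_of_norm_le_add_integral (z := z)
      (g := fun t s => NormedSpace.exp ((t - s) • An) (D.BRB (P s (z s) + r s)))
      hzc.continuousOn (by positivity) (by positivity) ?_ ?_
    · intro t ht s hs
      have hs' : s ∈ Icc 0 T := ⟨hs.1, hs.2.trans ht.2⟩
      calc _ ≤ c * (‖D.BRB‖ * (p * ‖z s‖ + C * ‖z s‖)) := by
            refine ContinuousLinearMap.le_of_opNorm_le_of_le _
              (hAn _ ⟨by linarith [hs.2], by linarith [hs.1, ht.2]⟩) ?_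
            refine ContinuousLinearMap.le_of_opNorm_le_of_le _ le_rfl ?_
            refine norm_add_le_of_le (ContinuousLinearMap.le_of_opNorm_le _ (hp s hs') _) ?_
            simp only [hr, hζη s hs']
            exact ContinuousLinearMap.le_of_opNorm_le _ (hC s hs') _
        _ = c * (‖D.BRB‖ * (p + C)) * ‖z s‖ := by ring
        _ ≤ _ := by gcongr; linarith
    · intro t ht
      conv_lhs => rw [hzeq t ht]
      exact (norm_sub_le _ _).trans
        (add_le_add (ContinuousLinearMap.le_of_opNorm_le _ (hAn t ht) _) le_rfl)
  · simp only [hr, hζη t ht]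
    exact ContinuousLinearMap.le_of_opNorm_le _ (hC t ht) _
  · have hexpt : Continuous fun s => NormedSpace.exp ((t - s) • An) :=
      hexpc.comp (continuous_const.sub continuous_id)
    have i1 : Continuous fun s => NormedSpace.exp ((t - s) • An) (D.BRB (P s (z s))) :=
      hexpt.clm_apply (D.BRB.continuous.comp hPz)
    have i2 : Continuous fun s => NormedSpace.exp ((t - s) • An) (D.BRB (r s)) :=
      hexpt.clm_apply (D.BRB.continuous.comp hrc)
    rw [hzeq t ht, sub_sub]
    simp only [map_add]
    rw [intervalIntegral.integral_add (i1.intervalIntegrable _ _) (i2.intervalIntegrable _ _)]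
  · have hvc : Continuous fun s => P s (D.BRB (r s)) + D.Qbar (D.S (z s)) :=
      hPr.add (D.Qbar.continuous.comp (D.S.continuous.comp hzc))
    have h1 := exp_apply_sub_eq_integral hvc hr' ht.1 ht.2 le_rfl t
    simp only [hneg, hexpadj, sub_self, zero_smul, NormedSpace.exp_zero] at h1
    have h2 : r T = -(D.QbarT (D.ST (z T))) := by
      simp only [hr, hζη T ⟨hT, le_rfl⟩, hη.terminal]
      simp
    have hexpt : Continuous fun s =>
        ContinuousLinearMap.adjoint (NormedSpace.exp ((s - t) • An)) :=
      (ContinuousLinearMap.adjoint (𝕜 := ℝ) (E := H) (F := H)).continuous.comp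
        (hexpc.comp (continuous_id.sub continuous_const))
    have i1 : Continuous fun s => ContinuousLinearMap.adjoint (NormedSpace.exp ((s - t) • An))
        (P s (D.BRB (r s))) := hexpt.clm_apply hPr
    have i2 : Continuous fun s => ContinuousLinearMap.adjoint (NormedSpace.exp ((s - t) • An))
        (D.Qbar (D.S (z s))) :=
      hexpt.clm_apply (D.Qbar.continuous.comp (D.S.continuous.comp hzc))
    simp only [map_add] at h1
    rw [h2, one_apply_eq_self, intervalIntegral.integral_add (i1.intervalIntegrable _ _)
      (i2.intervalIntegrable _ _)] at h1
    rw [sub_sub, h1]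
    abel

end Approximation

/-! ### Weak convergence in Hilbert space and in `L²` -/

section WeakConvergence

/-- Bounded sequences in a separable Hilbert space have weakly convergent subsequences. -/
theorem exists_subseq_tendsto_inner {X : Type*} [NormedAddCommGroup X] [InnerProductSpace ℝ X]
    [CompleteSpace X] [TopologicalSpace.SeparableSpace X] {x : ℕ → X} {C : ℝ}
    (hx : ∀ n, ‖x n‖ ≤ C) :
    ∃ φ : ℕ → ℕ, StrictMono φ ∧ ∃ y : X, ∀ w : X,
      Tendsto (fun n => inner ℝ (x (φ n)) w) atTop (𝓝 (inner ℝ y w)) := by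
  have hmem : ∀ n, StrongDual.toWeakDual (InnerProductSpace.toDual ℝ X (x n)) ∈
      WeakDual.toStrongDual ⁻¹' Metric.closedBall (0 : StrongDual ℝ X) C := fun n => by
    simpa using hx n
  obtain ⟨f, -, φ, hφ, hlim⟩ := WeakDual.isSeqCompact_closedBall ℝ X 0 C hmem
  refine ⟨φ, hφ, (InnerProductSpace.toDual ℝ X).symm (WeakDual.toStrongDual f), fun w => ?_⟩
  have h1 := ((WeakDual.eval_continuous (𝕜 := ℝ) w).tendsto f).comp hlim
  rw [InnerProductSpace.toDual_symm_apply]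
  exact h1

variable {α H : Type*} [MeasurableSpace α] {μ : Measure α} [NormedAddCommGroup H]
  [InnerProductSpace ℝ H]

/-- Weak convergence in `L²`. -/
def WeaklyConverges (μ : Measure α) (u : ℕ → α → H) (Z : α → H) : Prop :=
  MemLp Z 2 μ ∧ ∀ g : α → H, MemLp g 2 μ →
    Tendsto (fun n => ∫ s, inner ℝ (u n s) (g s) ∂μ) atTop (𝓝 (∫ s, inner ℝ (Z s) (g s) ∂μ))

theorem WeaklyConverges.comp {u : ℕ → α → H} {Z : α → H} (h : WeaklyConverges μ u Z)
    {φ : ℕ → ℕ} (hφ : StrictMono φ) : WeaklyConverges μ (fun n => u (φ n)) Z :=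
  ⟨h.1, fun g hg => (h.2 g hg).comp hφ.tendsto_atTop⟩

theorem integrable_inner_of_memLp {f g : α → H} (hf : MemLp f 2 μ) (hg : MemLp g 2 μ) :
    Integrable (fun s => inner ℝ (f s) (g s)) μ := by
  refine (hf.norm.integrable_mul hg.norm).mono (hf.1.inner hg.1)
    (Eventually.of_forall fun s => ?_)
  simpa using norm_inner_le_norm (𝕜 := ℝ) (f s) (g s)

/-- A uniform bound on a finite measure space gives a bound in `L²(μ; H)`, a separable Hilbert space
because `μ` lives on a countably generated σ-algebra and `H` is separable. -/
theorem exists_subseq_weaklyConverges [CompleteSpace H] [TopologicalSpace.SeparableSpace H]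
    [IsFiniteMeasure μ] [MeasurableSpace.CountablyGenerated α] {u : ℕ → α → H} {C : ℝ}
    (hu : ∀ n, AEStronglyMeasurable (u n) μ) (hC : ∀ n, ∀ᵐ s ∂μ, ‖u n s‖ ≤ C) (hC0 : 0 ≤ C) :
    ∃ φ : ℕ → ℕ, StrictMono φ ∧ ∃ Z, WeaklyConverges μ (fun n => u (φ n)) Z := by
  have : Fact ((2 : ENNReal) ≠ ⊤) := ⟨by norm_num⟩
  have hmem : ∀ n, MemLp (u n) 2 μ := fun n => MemLp.of_bound (hu n) C (hC n)
  obtain ⟨φ, hφ, Y, hY⟩ := exists_subseq_tendsto_inner (X := Lp H 2 μ)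
    (x := fun n => (hmem n).toLp (u n)) (fun n => Lp.norm_le_of_ae_bound hC0 (by
      filter_upwards [(hmem n).coeFn_toLp, hC n] with s h1 h2
      rwa [h1]))
  refine ⟨φ, hφ, Y, Lp.memLp Y, fun g hg => ?_⟩
  have h := hY (hg.toLp g)
  simp only [L2.inner_def] at h
  have e : ∀ f : α → H, ∫ a, inner ℝ (f a) ((hg.toLp g) a) ∂μ = ∫ a, inner ℝ (f a) (g a) ∂μ :=
    fun f => integral_congr_ae (by filter_upwards [hg.coeFn_toLp] with s hs; rw [hs])
  simp only [e] at h
  refine h.congr fun n => integral_congr_ae ?_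
  filter_upwards [(hmem (φ n)).coeFn_toLp] with s hs
  rw [hs]

/-- Weak convergence may be tested against boundedly convergent functions. -/
theorem WeaklyConverges.tendsto_integral_inner [IsFiniteMeasure μ] {u : ℕ → α → H} {Z : α → H}
    (hZ : WeaklyConverges μ u Z) {C c : ℝ} (hu : ∀ n, AEStronglyMeasurable (u n) μ)
    (hC : ∀ n, ∀ᵐ s ∂μ, ‖u n s‖ ≤ C) {h : ℕ → α → H} {h' : α → H}
    (hh : ∀ n, AEStronglyMeasurable (h n) μ) (hc : ∀ n, ∀ᵐ s ∂μ, ‖h n s‖ ≤ c)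
    (hlim : ∀ᵐ s ∂μ, Tendsto (fun n => h n s) atTop (𝓝 (h' s))) :
    Tendsto (fun n => ∫ s, inner ℝ (u n s) (h n s) ∂μ) atTop
      (𝓝 (∫ s, inner ℝ (Z s) (h' s) ∂μ)) := by
  have hh'm : AEStronglyMeasurable h' μ := aestronglyMeasurable_of_tendsto_ae atTop hh hlim
  have hc' : ∀ᵐ s ∂μ, ‖h' s‖ ≤ c := by
    filter_upwards [hlim, ae_all_iff.2 hc] with s hs hs'
    exact le_of_tendsto' hs.norm hs'
  have hh' : MemLp h' 2 μ := MemLp.of_bound hh'm c hc'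
  have hum : ∀ n, MemLp (u n) 2 μ := fun n => MemLp.of_bound (hu n) C (hC n)
  have hhm : ∀ n, MemLp (h n) 2 μ := fun n => MemLp.of_bound (hh n) c (hc n)
  have h1 := hZ.2 h' hh'
  have h2 : Tendsto (fun n => ∫ s, inner ℝ (u n s) (h n s - h' s) ∂μ) atTop
      (𝓝 (∫ _, (0 : ℝ) ∂μ)) := by
    refine tendsto_integral_of_dominated_convergence (fun _ => C * (c + c))
      (fun n => (hu n).inner ((hh n).sub hh'm)) (integrable_const _) (fun n => ?_) ?_
    · filter_upwards [hC n, hc n, hc'] with s h1 h2 h3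
      refine (norm_inner_le_norm _ _).trans ?_
      exact mul_le_mul h1 ((norm_sub_le _ _).trans (add_le_add h2 h3)) (norm_nonneg _)
        ((norm_nonneg _).trans h1)
    · filter_upwards [ae_all_iff.2 hC, hlim] with s hs hl
      have h3 : Tendsto (fun n => C * ‖h n s - h' s‖) atTop (𝓝 0) := by
        simpa using (tendsto_iff_norm_sub_tendsto_zero.1 hl).const_mul C
      refine squeeze_zero_norm (fun n => ?_) h3
      refine (norm_inner_le_norm _ _).trans ?_
      gcongr
      exact hs n
  have h3 := h2.add h1
  simp only [integral_zero, zero_add] at h3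
  refine h3.congr fun n => ?_
  have hi : Integrable (fun s => inner ℝ (u n s) (h n s - h' s)) μ :=
    integrable_inner_of_memLp (hum n) ((hhm n).sub hh')
  rw [← integral_add hi (integrable_inner_of_memLp (hum n) hh')]
  refine integral_congr_ae (Eventually.of_forall fun s => ?_)
  simp only [← inner_add_right, sub_add_cancel]

/-- The weak `L²` limit is the pointwise weak limit, if the latter exists. -/
theorem WeaklyConverges.ae_eq [IsFiniteMeasure μ] {u : ℕ → α → H} {Z z : α → H}
    (hZ : WeaklyConverges μ u Z) {C : ℝ} (hu : ∀ n, AEStronglyMeasurable (u n) μ)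
    (hC : ∀ n, ∀ᵐ s ∂μ, ‖u n s‖ ≤ C) (hz : MemLp z 2 μ)
    (hlim : ∀ᵐ s ∂μ, ∀ y, Tendsto (fun n => inner ℝ (u n s) y) atTop (𝓝 (inner ℝ (z s) y))) :
    Z =ᵐ[μ] z := by
  -- Testing both convergences against `Z - z` itself gives the vanishing of the integral of `‖Z -
  -- z‖²`.
  have hd : MemLp (Z - z) 2 μ := hZ.1.sub hz
  have h1 := hZ.2 _ hd
  have h2 : Tendsto (fun n => ∫ s, inner ℝ (u n s) ((Z - z) s) ∂μ) atTop
      (𝓝 (∫ s, inner ℝ (z s) ((Z - z) s) ∂μ)) := by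
    refine tendsto_integral_of_dominated_convergence (fun s => C * ‖(Z - z) s‖)
      (fun n => (hu n).inner hd.1) ((hd.integrable (by norm_num)).norm.const_mul C)
      (fun n => ?_) ?_
    · filter_upwards [hC n] with s hs
      refine (norm_inner_le_norm _ _).trans ?_
      gcongr
    · filter_upwards [hlim] with s hs
      exact hs _
  have h3 := tendsto_nhds_unique h1 h2
  have h4 : ∫ s, ‖(Z - z) s‖ ^ 2 ∂μ = 0 := by
    rw [← sub_eq_zero, ← integral_sub (integrable_inner_of_memLp hZ.1 hd)
      (integrable_inner_of_memLp hz hd)] at h3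
    rw [← h3]
    refine integral_congr_ae (Eventually.of_forall fun s => ?_)
    simp only [← inner_sub_left, Pi.sub_apply, real_inner_self_eq_norm_sq]
  have h5 : Integrable (fun s => ‖(Z - z) s‖ ^ 2) μ := by
    refine (integrable_inner_of_memLp hd hd).congr (Eventually.of_forall fun s => ?_)
    simp only [real_inner_self_eq_norm_sq]
  rw [integral_eq_zero_iff_of_nonneg (fun s => by positivity) h5] at h4
  filter_upwards [h4] with s hs
  have : ‖(Z - z) s‖ ^ 2 = 0 := hs
  rw [sq_eq_zero_iff, norm_eq_zero] at this
  exact sub_eq_zero.1 this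

/-- The pairing of a weakly and a strongly convergent sequence converges. -/
theorem tendsto_inner_of_weak_of_strong {x w : ℕ → H} {y v : H} {C : ℝ} (hC : ∀ n, ‖x n‖ ≤ C)
    (hx : ∀ b, Tendsto (fun n => inner ℝ (x n) b) atTop (𝓝 (inner ℝ y b)))
    (hw : Tendsto w atTop (𝓝 v)) :
    Tendsto (fun n => inner ℝ (x n) (w n)) atTop (𝓝 (inner ℝ y v)) := by
  have h1 : Tendsto (fun n => C * ‖w n - v‖) atTop (𝓝 0) := by
    simpa using (tendsto_iff_norm_sub_tendsto_zero.1 hw).const_mul C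
  have h2 : Tendsto (fun n => inner ℝ (x n) (w n - v)) atTop (𝓝 0) := by
    refine squeeze_zero_norm (fun n => ?_) h1
    refine (norm_inner_le_norm _ _).trans ?_
    gcongr
    exact hC n
  have h3 := h2.add (hx v)
  simp only [← inner_add_right, sub_add_cancel, zero_add] at h3
  exact h3

end WeakConvergence

/-! ### Volterra integrals under weak limits -/

section Volterra

variable {H : Type*} [NormedAddCommGroup H] [InnerProductSpace ℝ H] [CompleteSpace H]
  {T : ℝ} {J : Set ℝ} {τ : ℝ → ℝ}

theorem integrableOn_volterra {L Φ : ℝ → H →L[ℝ] H} (hL : ∀ x, Continuous fun t => L t x)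
    (hΦ : ∀ x, Continuous fun t => Φ t x) (hJ : J ⊆ Ioc 0 T) (hJm : MeasurableSet J)
    (hτ : Continuous τ) {c : ℝ} (hc : ∀ s ∈ J, ‖L (τ s)‖ ≤ c) {u : ℝ → H}
    (hu : IntegrableOn u (Ioc 0 T)) : IntegrableOn (fun s => L (τ s) (Φ s (u s))) J := by
  obtain ⟨p, hp0, hp⟩ := exists_norm_le_of_strongly_continuous hΦ 0 T
  have huJ : IntegrableOn u J := hu.mono_set hJ
  refine Integrable.mono' (huJ.norm.const_mul (c * p)) ?_ ?_
  · exact aestronglyMeasurable_clm_apply hL hτ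
      (aestronglyMeasurable_clm_apply hΦ continuous_id huJ.1)
  · filter_upwards [ae_restrict_mem hJm] with s hs
    rw [mul_assoc]
    exact ContinuousLinearMap.le_of_opNorm_le_of_le _ (hc s hs)
      (ContinuousLinearMap.le_of_opNorm_le _ (hp s ⟨(hJ hs).1.le, (hJ hs).2⟩) _)

/-- All operators move onto the test vector, and extension by zero outside `J` makes the integral a
pairing on the fixed interval `(0, T]`. The dependence on `u` is then in the form to which weak `L²`
convergence applies. -/
theorem inner_volterra {L Φ Ψ : ℝ → H →L[ℝ] H} (hL : ∀ x, Continuous fun t => L t x)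
    (hΦ : ∀ x, Continuous fun t => Φ t x)
    (hΦΨ : ∀ s ∈ Icc 0 T, ∀ x y, inner ℝ (Φ s x) y = inner ℝ x (Ψ s y))
    (hJ : J ⊆ Ioc 0 T) (hJm : MeasurableSet J)
    (hτ : Continuous τ) {c : ℝ} (hc : ∀ s ∈ J, ‖L (τ s)‖ ≤ c) {u : ℝ → H}
    (hu : IntegrableOn u (Ioc 0 T)) (y : H) :
    inner ℝ (∫ s in J, L (τ s) (Φ s (u s))) y
      = ∫ s in Ioc 0 T, inner ℝ (u s)
        (J.indicator (fun s => Ψ s (ContinuousLinearMap.adjoint (L (τ s)) y)) s) := by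
  have hint := integrableOn_volterra hL hΦ hJ hJm hτ hc hu
  have h1 := (innerSL ℝ y).integral_comp_comm hint
  simp only [innerSL_apply_apply] at h1
  rw [real_inner_comm, ← h1]
  have h2 : (fun s => inner ℝ (u s)
      (J.indicator (fun s => Ψ s (ContinuousLinearMap.adjoint (L (τ s)) y)) s))
      = J.indicator fun s => inner ℝ (u s) (Ψ s (ContinuousLinearMap.adjoint (L (τ s)) y)) := by
    ext s
    by_cases hs : s ∈ J <;> simp [hs]
  rw [h2, setIntegral_indicator hJm, inter_eq_right.2 hJ]
  refine setIntegral_congr_fun hJm fun s hs => ?_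
  have hs' : s ∈ Icc 0 T := ⟨(hJ hs).1.le, (hJ hs).2⟩
  rw [real_inner_comm, ← ContinuousLinearMap.adjoint_inner_right, hΦΨ s hs']

/-- Volterra integrals with strongly convergent adjoint kernels pass to weak limits. -/
theorem tendsto_inner_volterra {Ln : ℕ → ℝ → H →L[ℝ] H} {L Φ Ψ : ℝ → H →L[ℝ] H}
    (hLn : ∀ n x, Continuous fun t => Ln n t x)
    (hLn' : ∀ n x, Continuous fun t => ContinuousLinearMap.adjoint (Ln n t) x)
    (hL : ∀ x, Continuous fun t => L t x)
    (hΦ : ∀ x, Continuous fun t => Φ t x) (hΨ : ∀ x, Continuous fun t => Ψ t x)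
    (hΦΨ : ∀ s ∈ Icc 0 T, ∀ x y, inner ℝ (Φ s x) y = inner ℝ x (Ψ s y))
    (hJ : J ⊆ Ioc 0 T) (hJm : MeasurableSet J)
    (hτ : Continuous τ) {c C : ℝ} (hcn : ∀ n, ∀ s ∈ J, ‖Ln n (τ s)‖ ≤ c)
    (hc : ∀ s ∈ J, ‖L (τ s)‖ ≤ c) {u : ℕ → ℝ → H} {Z : ℝ → H} (hu : ∀ n, Continuous (u n))
    (hC : ∀ n, ∀ t ∈ Icc 0 T, ‖u n t‖ ≤ C)
    (hZ : WeaklyConverges (volume.restrict (Ioc 0 T)) u Z) (y : H)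
    (hlim : ∀ s ∈ J, Tendsto (fun n => ContinuousLinearMap.adjoint (Ln n (τ s)) y) atTop
      (𝓝 (ContinuousLinearMap.adjoint (L (τ s)) y))) :
    Tendsto (fun n => inner ℝ (∫ s in J, Ln n (τ s) (Φ s (u n s))) y) atTop
      (𝓝 (inner ℝ (∫ s in J, L (τ s) (Φ s (Z s))) y)) := by
  obtain ⟨p, hp0, hp⟩ := exists_norm_le_of_strongly_continuous hΨ 0 T
  have hui : ∀ n, IntegrableOn (u n) (Ioc 0 T) := fun n =>
    (hu n).continuousOn.integrableOn_Icc.mono_set Ioc_subset_Icc_self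
  have hZi : IntegrableOn Z (Ioc 0 T) := hZ.1.integrable (by norm_num)
  rw [inner_volterra hL hΦ hΦΨ hJ hJm hτ hc hZi]
  simp only [fun n => inner_volterra (hLn n) hΦ hΦΨ hJ hJm hτ (hcn n) (hui n) y]
  refine hZ.tendsto_integral_inner (C := C) (c := p * (|c| * ‖y‖))
    (fun n => (hu n).aestronglyMeasurable) (fun n => ?_)
    (fun n => ?_) (fun n => ?_) (Eventually.of_forall fun s => ?_)
  · filter_upwards [ae_restrict_mem measurableSet_Ioc] with s hs
    exact hC n s ⟨hs.1.le, hs.2⟩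
  · refine AEStronglyMeasurable.indicator ?_ hJm
    exact (continuous_clm_apply_of_strongly_continuous hΨ continuous_id
      ((hLn' n y).comp hτ)).aestronglyMeasurable
  · refine Eventually.of_forall fun s => ?_
    by_cases hs : s ∈ J
    · have hs' : s ∈ Icc 0 T := ⟨(hJ hs).1.le, (hJ hs).2⟩
      rw [indicator_of_mem hs]
      refine ContinuousLinearMap.le_of_opNorm_le_of_le _ (hp s hs') ?_
      refine ContinuousLinearMap.le_of_opNorm_le _ ?_ _
      rw [LinearIsometryEquiv.norm_map]
      exact (hcn n s hs).trans (le_abs_self c)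
    · rw [indicator_of_notMem hs, norm_zero]
      positivity
  · by_cases hs : s ∈ J
    · simp only [indicator_of_mem hs]
      exact ((Ψ s).continuous.tendsto _).comp (hlim s hs)
    · simp only [indicator_of_notMem hs]
      exact tendsto_const_nhds

/-- Volterra integrals of integrable functions depend continuously on the time variable. -/
theorem continuousOn_volterra_aux {L : ℝ → H →L[ℝ] H} (hL : ∀ x, Continuous fun t => L t x)
    {v : ℝ → H} (hv : IntegrableOn v (Ioc 0 T)) {ε : ℝ} (hε : ε = 1 ∨ ε = -1) :
    ContinuousOn (fun t => ∫ s in Ioc 0 T,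
      (Ici (0 : ℝ)).indicator (fun τ => L τ (v s)) (ε * (t - s))) (Icc 0 T) := by
  obtain ⟨c, hc0, hc⟩ := exists_norm_le_of_strongly_continuous hL 0 T
  have hε0 : ε ≠ 0 := by rcases hε with h | h <;> rw [h] <;> norm_num
  intro t₀ ht₀
  refine continuousWithinAt_of_dominated (bound := fun s => c * ‖v s‖) ?_ ?_
    (hv.norm.const_mul c) ?_
  · refine Eventually.of_forall fun t => ?_
    have h1 : (fun s => (Ici (0 : ℝ)).indicator (fun τ => L τ (v s)) (ε * (t - s)))
        = ((fun s => ε * (t - s)) ⁻¹' Ici 0).indicator (fun s => L (ε * (t - s)) (v s)) := by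
      ext s
      simp only [indicator, mem_preimage]
    have hτ : Continuous fun s : ℝ => ε * (t - s) := by fun_prop
    rw [h1]
    exact (aestronglyMeasurable_clm_apply hL hτ hv.1).indicator (hτ.measurable measurableSet_Ici)
  · filter_upwards [self_mem_nhdsWithin] with t ht
    filter_upwards [ae_restrict_mem measurableSet_Ioc] with s hs
    by_cases hmem : ε * (t - s) ∈ Ici (0 : ℝ)
    · rw [indicator_of_mem hmem]
      refine ContinuousLinearMap.le_of_opNorm_le _ (hc _ ⟨hmem, ?_⟩) _
      rcases hε with h | h <;> rw [h] <;> linarith [ht.1, ht.2, hs.1, hs.2]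
    · rw [indicator_of_notMem hmem, norm_zero]
      positivity
  · have hne : ∀ᵐ s ∂(volume.restrict (Ioc 0 T)), s ≠ t₀ :=
      ae_restrict_of_ae (Measure.ae_ne volume t₀)
    filter_upwards [hne] with s hs
    refine ContinuousAt.continuousWithinAt ?_
    have hτ : Continuous fun t : ℝ => ε * (t - s) := by fun_prop
    have h0 : ε * (t₀ - s) ≠ 0 := mul_ne_zero hε0 (sub_ne_zero.2 hs.symm)
    have h1 : ContinuousAt ((Ici (0 : ℝ)).indicator fun τ => L τ (v s)) (ε * (t₀ - s)) := by
      rcases lt_or_gt_of_ne h0 with h | h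
      · have : (Ici (0 : ℝ)).indicator (fun τ => L τ (v s)) =ᶠ[𝓝 (ε * (t₀ - s))] fun _ => 0 := by
          filter_upwards [Iio_mem_nhds h] with τ hτ
          exact indicator_of_notMem (by simpa using hτ) _
        exact continuousAt_const.congr this.symm
      · have : (Ici (0 : ℝ)).indicator (fun τ => L τ (v s)) =ᶠ[𝓝 (ε * (t₀ - s))]
            fun τ => L τ (v s) := by
          filter_upwards [Ioi_mem_nhds h] with τ hτ
          exact indicator_of_mem (le_of_lt hτ) _
        exact (hL (v s)).continuousAt.congr this.symm
    exact ContinuousAt.comp (f := fun t => ε * (t - s)) h1 hτ.continuousAt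

theorem continuousOn_volterra_forward {L : ℝ → H →L[ℝ] H} (hL : ∀ x, Continuous fun t => L t x)
    {v : ℝ → H} (hv : IntegrableOn v (Ioc 0 T)) :
    ContinuousOn (fun t => ∫ s in Ioc 0 t, L (t - s) (v s)) (Icc 0 T) := by
  refine (continuousOn_volterra_aux hL hv (Or.inl rfl)).congr fun t ht => ?_
  have h1 : (fun s => (Ici (0 : ℝ)).indicator (fun τ => L τ (v s)) (1 * (t - s)))
      = (Iic t).indicator (fun s => L (t - s) (v s)) := by
    ext s
    simp [indicator]
  have h2 : Ioc 0 T ∩ Iic t = Ioc 0 t := by rw [Ioc_inter_Iic, min_eq_right ht.2]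
  simp only [h1]
  rw [setIntegral_indicator measurableSet_Iic, h2]

theorem continuousOn_volterra_backward {L : ℝ → H →L[ℝ] H} (hL : ∀ x, Continuous fun t => L t x)
    {v : ℝ → H} (hv : IntegrableOn v (Ioc 0 T)) :
    ContinuousOn (fun t => ∫ s in Ioc t T, L (s - t) (v s)) (Icc 0 T) := by
  refine (continuousOn_volterra_aux hL hv (Or.inr rfl)).congr fun t ht => ?_
  have h1 : (fun s => (Ici (0 : ℝ)).indicator (fun τ => L τ (v s)) (-1 * (t - s)))
      = (Ici t).indicator (fun s => L (s - t) (v s)) := by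
    ext s
    simp [indicator]
  have h2 : (Ioc 0 T ∩ Ici t : Set ℝ) =ᵐ[volume] Ioc t T := by
    have : (Ioc 0 T ∩ Ioi t : Set ℝ) = Ioc t T := by
      rw [Ioc_inter_Ioi, max_eq_right ht.1]
    rw [← this]
    exact (ae_eq_refl _).inter Ioi_ae_eq_Ici.symm
  simp only [h1]
  rw [setIntegral_indicator measurableSet_Ici, setIntegral_congr_set h2]

end Volterra

/-! ### The forward-backward system in the limit -/

section ForwardBackward

variable {H K U : Type*}
  [NormedAddCommGroup H] [InnerProductSpace ℝ H] [CompleteSpace H]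
  [TopologicalSpace.SeparableSpace H]
  [NormedAddCommGroup K] [InnerProductSpace ℝ K]
  [NormedAddCommGroup U] [InnerProductSpace ℝ U] [CompleteSpace U]

/-- Solvability of the forward-backward system, as a weak limit of the solutions of the systems
with the Yosida approximations. -/
theorem Coefficients.Standing.exists_isMildForwardBackward {D : Coefficients H K U}
    (hD : D.Standing) {T : ℝ} (hT : 0 ≤ T) {P : ℝ → H →L[ℝ] H}
    (hPc : ∀ x, Continuous fun t => P t x) (hPpos : ∀ t ∈ Icc 0 T, (P t).IsPositive)
    (hη : D.YosidaRiccatiSolvable T P) (z₀ : H) :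
    ∃ z r : ℝ → H, D.IsMildForwardBackward T z₀ P z r := by
  have h0T : (0 : ℝ) ∈ Icc 0 T := ⟨le_rfl, hT⟩
  obtain ⟨N, C, hN⟩ := hη
  obtain ⟨c₁, hc₁, N', hN'⟩ := exists_forall_norm_exp_yosida_le hD.semigroup hD.generator T
  obtain ⟨p, hp0, hp⟩ := exists_norm_le_of_strongly_continuous hPc 0 T
  have he := hD.isSemigroupFamily
  set e : ℝ → H →L[ℝ] H := fun t => D.expA (max t 0) with he_def
  have he_eq : ∀ t, 0 ≤ t → e t = D.expA t := fun t ht => by simp only [he_def, max_eq_left ht]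
  obtain ⟨c₂, hc₂, hec⟩ := exists_norm_le_of_strongly_continuous he.cont 0 T
  -- the approximating solutions
  have hex : ∀ n : ℕ, ∃ z r : ℝ → H, _ := fun n => by
    obtain ⟨η, hη, hηC⟩ := hN (n + (N + N')) (by lia)
    exact hη.exists_forwardBackward hT hPc hηC hc₁ (hN' (n + (N + N')) (by lia)) hp z₀
  choose zn rn hznc hrnc hzn hrn hzeq hreq using hex
  have hC0 : 0 ≤ C := by
    obtain ⟨η, -, hηC⟩ := hN N le_rfl
    exact (norm_nonneg _).trans (hηC 0 h0T)
  set b := 2 * (c₁ * ‖z₀‖) * Real.exp (2 * (c₁ * (‖D.BRB‖ * (p + C)) + 1) * T) with hb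
  have hb0 : 0 ≤ b := by positivity
  have hrn' : ∀ n, ∀ t ∈ Icc 0 T, ‖rn n t‖ ≤ C * b := fun n t ht =>
    (hrn n t ht).trans (mul_le_mul_of_nonneg_left (hzn n t ht) hC0)
  have hae : ∀ {u : ℝ → H} {M : ℝ}, (∀ t ∈ Icc 0 T, ‖u t‖ ≤ M) →
      ∀ᵐ s ∂(volume.restrict (Ioc 0 T)), ‖u s‖ ≤ M := fun hu => by
    filter_upwards [ae_restrict_mem measurableSet_Ioc] with s hs
    exact hu s ⟨hs.1.le, hs.2⟩
  obtain ⟨φ₁, hφ₁, Z, hZ⟩ := exists_subseq_weaklyConverges (μ := volume.restrict (Ioc 0 T))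
    (fun n => (hznc n).aestronglyMeasurable) (fun n => hae (hzn n)) hb0
  obtain ⟨φ₂, hφ₂, R, hR⟩ := exists_subseq_weaklyConverges (μ := volume.restrict (Ioc 0 T))
    (u := fun n => rn (φ₁ n)) (fun n => (hrnc _).aestronglyMeasurable) (fun n => hae (hrn' _))
    (by positivity : 0 ≤ C * b)
  replace hZ := hZ.comp hφ₂
  -- The approximations start at index `N + N'`, where both `η_n` and the uniform exponential bound
  -- are available.
  set k : ℕ → ℕ := fun n => φ₁ (φ₂ n) + (N + N') with hk
  have hk_tendsto : Tendsto k atTop atTop :=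
    tendsto_atTop_mono (fun n => Nat.le_add_right _ _) (hφ₁.comp hφ₂).tendsto_atTop
  have hkN' : ∀ n, N' ≤ k n := fun n => by simp only [hk]; lia
  set En : ℕ → ℝ → H →L[ℝ] H := fun n s => NormedSpace.exp (s • yosida D.A (k n)) with hEn
  have hEnc' : ∀ n, Continuous (En n) := fun n =>
    continuous_iff_continuousAt.2 fun s =>
      (hasDerivAt_exp_smul_const (yosida D.A (k n)) s).continuousAt
  have hEnc : ∀ n x, Continuous fun s => En n s x := fun n x =>
    (hEnc' n).clm_apply continuous_const
  have hEnc_adj : ∀ n x, Continuous fun s => ContinuousLinearMap.adjoint (En n s) x := fun n x =>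
    ((ContinuousLinearMap.adjoint (𝕜 := ℝ) (E := H) (F := H)).continuous.comp
      (hEnc' n)).clm_apply continuous_const
  set c := max c₁ c₂ with hc
  have hEn_le : ∀ n, ∀ t ∈ Icc 0 T, ‖En n t‖ ≤ c := fun n t ht =>
    (hN' (k n) (hkN' n) t ht).trans (le_max_left _ _)
  have he_le : ∀ t ∈ Icc 0 T, ‖e t‖ ≤ c := fun t ht => (hec t ht).trans (le_max_right _ _)
  have hlim : ∀ t, 0 ≤ t → ∀ x, Tendsto (fun n => En n t x) atTop (𝓝 (e t x)) :=
    fun t ht x => by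
      rw [he_eq t ht]
      exact (tendsto_exp_yosida hD.semigroup hD.generator hD.dense_domain ht x).1.comp hk_tendsto
  have hlim_adj : ∀ t, 0 ≤ t → ∀ x, Tendsto (fun n => ContinuousLinearMap.adjoint (En n t) x) atTop
      (𝓝 (ContinuousLinearMap.adjoint (e t) x)) := fun t ht x => by
    rw [he_eq t ht]
    exact (tendsto_exp_yosida hD.semigroup hD.generator hD.dense_domain ht x).2.comp hk_tendsto
  -- passage to the limit in the integral terms
  have hforward : ∀ {Φ Ψ : ℝ → H →L[ℝ] H}, (∀ x, Continuous fun t => Φ t x) →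
      (∀ x, Continuous fun t => Ψ t x) →
      (∀ s ∈ Icc 0 T, ∀ x y, inner ℝ (Φ s x) y = inner ℝ x (Ψ s y)) →
      ∀ {u : ℕ → ℝ → H} {V : ℝ → H} {M : ℝ}, (∀ n, Continuous (u n)) →
      (∀ n, ∀ t ∈ Icc 0 T, ‖u n t‖ ≤ M) → WeaklyConverges (volume.restrict (Ioc 0 T)) u V →
      ∀ t ∈ Icc 0 T, ∀ y, Tendsto
        (fun n => inner ℝ (∫ s in (0 : ℝ)..t, En n (t - s) (Φ s (u n s))) y) atTop
        (𝓝 (inner ℝ (∫ s in Ioc 0 t, e (t - s) (Φ s (V s))) y)) := by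
    intro Φ Ψ hΦ hΨ hΦΨ u V M hu hM hV t ht y
    simp only [intervalIntegral.integral_of_le ht.1]
    have hmem : ∀ s ∈ Ioc 0 t, t - s ∈ Icc 0 T := fun s hs =>
      ⟨by linarith [hs.2], by linarith [hs.1, ht.2]⟩
    exact tendsto_inner_volterra (τ := fun s => t - s) hEnc hEnc_adj he.cont hΦ hΨ hΦΨ
      (Ioc_subset_Ioc_right ht.2) measurableSet_Ioc (by fun_prop)
      (fun n s hs => hEn_le n _ (hmem s hs)) (fun s hs => he_le _ (hmem s hs)) hu hM hV y
      (fun s hs => hlim_adj _ (hmem s hs).1 y)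
  have hbackward : ∀ {Φ Ψ : ℝ → H →L[ℝ] H}, (∀ x, Continuous fun t => Φ t x) →
      (∀ x, Continuous fun t => Ψ t x) →
      (∀ s ∈ Icc 0 T, ∀ x y, inner ℝ (Φ s x) y = inner ℝ x (Ψ s y)) →
      ∀ {u : ℕ → ℝ → H} {V : ℝ → H} {M : ℝ}, (∀ n, Continuous (u n)) →
      (∀ n, ∀ t ∈ Icc 0 T, ‖u n t‖ ≤ M) → WeaklyConverges (volume.restrict (Ioc 0 T)) u V →
      ∀ t ∈ Icc 0 T, ∀ y, Tendsto
        (fun n => inner ℝ (∫ s in t..T,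
          ContinuousLinearMap.adjoint (En n (s - t)) (Φ s (u n s))) y) atTop
        (𝓝 (inner ℝ (∫ s in Ioc t T, ContinuousLinearMap.adjoint (e (s - t)) (Φ s (V s))) y)) := by
    intro Φ Ψ hΦ hΨ hΦΨ u V M hu hM hV t ht y
    simp only [intervalIntegral.integral_of_le ht.2]
    have hmem : ∀ s ∈ Ioc t T, s - t ∈ Icc 0 T := fun s hs =>
      ⟨by linarith [hs.1], by linarith [hs.2, ht.1]⟩
    refine tendsto_inner_volterra (τ := fun s => s - t) (c := c)
      (Ln := fun n s => ContinuousLinearMap.adjoint (En n s))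
      (L := fun s => ContinuousLinearMap.adjoint (e s)) hEnc_adj
      (fun n x => ?_) he.cont_adj hΦ hΨ hΦΨ (Ioc_subset_Ioc_left ht.1) measurableSet_Ioc
      (by fun_prop) (fun n s hs => ?_) (fun s hs => ?_) hu hM hV y (fun s hs => ?_)
    · simpa only [ContinuousLinearMap.adjoint_adjoint] using hEnc n x
    · rw [LinearIsometryEquiv.norm_map]
      exact hEn_le n _ (hmem s hs)
    · rw [LinearIsometryEquiv.norm_map]
      exact he_le _ (hmem s hs)
    · simpa only [ContinuousLinearMap.adjoint_adjoint] using hlim _ (hmem s hs).1 y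
  have hBRB : ∀ x y, inner ℝ (D.BRB x) y = inner ℝ x (D.BRB y) :=
    hD.isPositive_BRB.inner_left_eq_inner_right
  have hPs : ∀ s ∈ Icc 0 T, ∀ x y, inner ℝ (P s x) y = inner ℝ x (P s y) := fun s hs =>
    (hPpos s hs).inner_left_eq_inner_right
  have hKP : ∀ x, Continuous fun s => (D.BRB ∘L P s) x := fun x => D.BRB.continuous.comp (hPc x)
  have hPK : ∀ x, Continuous fun s => (P s ∘L D.BRB) x := fun x => hPc (D.BRB x)
  have hconst : ∀ L : H →L[ℝ] H, ∀ x, Continuous fun _ : ℝ => L x := fun L x => continuous_const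
  have hKPdual : ∀ s ∈ Icc 0 T, ∀ x y,
      inner ℝ ((D.BRB ∘L P s) x) y = inner ℝ x ((P s ∘L D.BRB) y) := fun s hs x y => by
    simp only [ContinuousLinearMap.comp_apply]
    rw [hBRB, hPs s hs]
  have hPKdual : ∀ s ∈ Icc 0 T, ∀ x y,
      inner ℝ ((P s ∘L D.BRB) x) y = inner ℝ x ((D.BRB ∘L P s) y) := fun s hs x y => by
    simp only [ContinuousLinearMap.comp_apply]
    rw [hPs s hs, hBRB]
  have hQSdual : ∀ s ∈ Icc 0 T, ∀ x y, inner ℝ ((D.Qbar ∘L D.S) x) y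
      = inner ℝ x (ContinuousLinearMap.adjoint (D.Qbar ∘L D.S) y) := fun s _ x y =>
    (ContinuousLinearMap.adjoint_inner_right _ _ _).symm
  -- the limit
  set z : ℝ → H := fun t => e t z₀ - (∫ s in Ioc 0 t, e (t - s) ((D.BRB ∘L P s) (Z s)))
    - ∫ s in Ioc 0 t, e (t - s) (D.BRB (R s)) with hz
  set r : ℝ → H := fun t =>
    ContinuousLinearMap.adjoint (e (T - t)) (-(D.QbarT (D.ST (z T))))
    - (∫ s in Ioc t T, ContinuousLinearMap.adjoint (e (s - t)) ((P s ∘L D.BRB) (R s)))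
    - ∫ s in Ioc t T, ContinuousLinearMap.adjoint (e (s - t)) ((D.Qbar ∘L D.S) (Z s)) with hr
  have hz_lim : ∀ t ∈ Icc 0 T, ∀ y, Tendsto (fun n => inner ℝ (zn (φ₁ (φ₂ n)) t) y) atTop
      (𝓝 (inner ℝ (z t) y)) := by
    intro t ht y
    have h1 := (hlim t ht.1 z₀).inner (𝕜 := ℝ) (tendsto_const_nhds (x := y))
    have h2 := hforward hKP hPK hKPdual (fun n => hznc _) (fun n => hzn _) hZ t ht y
    have h3 := hforward (hconst D.BRB) (hconst D.BRB) (fun _ _ => hBRB) (fun n => hrnc _)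
      (fun n => hrn' _) hR t ht y
    have h4 := (h1.sub h2).sub h3
    simp only [← inner_sub_left] at h4
    refine h4.congr fun n => ?_
    rw [hzeq _ t ht]
    rfl
  have hr_lim : ∀ t ∈ Icc 0 T, ∀ y, Tendsto (fun n => inner ℝ (rn (φ₁ (φ₂ n)) t) y) atTop
      (𝓝 (inner ℝ (r t) y)) := by
    intro t ht y
    have hTt : 0 ≤ T - t := by linarith [ht.2]
    have h1 : Tendsto (fun n => inner ℝ (ContinuousLinearMap.adjoint (En n (T - t))
        (-(D.QbarT (D.ST (zn (φ₁ (φ₂ n)) T))))) y) atTop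
        (𝓝 (inner ℝ (ContinuousLinearMap.adjoint (e (T - t)) (-(D.QbarT (D.ST (z T))))) y)) := by
      have hT' : T ∈ Icc 0 T := ⟨hT, le_rfl⟩
      -- The terminal value `z_n(T)` converges only weakly, so all operators are moved to the fixed
      -- side, where `En n (T - t) y` converges strongly.
      have hswap : ∀ (L : H →L[ℝ] H) (x : H), inner ℝ (ContinuousLinearMap.adjoint L
          (-(D.QbarT (D.ST x)))) y
          = inner ℝ x (-(ContinuousLinearMap.adjoint (D.QbarT ∘L D.ST) (L y))) := fun L x => by
        rw [ContinuousLinearMap.adjoint_inner_left, inner_neg_left, inner_neg_right,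
          ContinuousLinearMap.adjoint_inner_right]
        rfl
      simp only [hswap]
      refine tendsto_inner_of_weak_of_strong (fun n => hzn _ T hT') (hz_lim T hT') ?_
      exact (((ContinuousLinearMap.adjoint (D.QbarT ∘L D.ST)).continuous.tendsto _).comp
        (hlim _ hTt y)).neg
    have h2 := hbackward hPK hKP hPKdual (fun n => hrnc _) (fun n => hrn' _) hR t ht y
    have h3 := hbackward (hconst (D.Qbar ∘L D.S))
      (hconst (ContinuousLinearMap.adjoint (D.Qbar ∘L D.S))) hQSdual (fun n => hznc _)
      (fun n => hzn _) hZ t ht y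
    have h4 := (h1.sub h2).sub h3
    simp only [← inner_sub_left] at h4
    refine h4.congr fun n => ?_
    rw [hreq _ t ht]
    rfl
  -- continuity of the limit
  have hZi : IntegrableOn Z (Ioc 0 T) := hZ.1.integrable (by norm_num)
  have hRi : IntegrableOn R (Ioc 0 T) := hR.1.integrable (by norm_num)
  have hint : ∀ {Φ : ℝ → H →L[ℝ] H}, (∀ x, Continuous fun t => Φ t x) → ∀ {u : ℝ → H},
      IntegrableOn u (Ioc 0 T) → IntegrableOn (fun s => Φ s (u s)) (Ioc 0 T) := fun hΦ _ hu =>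
    integrableOn_volterra (L := fun _ => ContinuousLinearMap.id ℝ H) (τ := id)
      (fun _ => continuous_const) hΦ Subset.rfl measurableSet_Ioc continuous_id
      (fun _ _ => ContinuousLinearMap.norm_id_le) hu
  have hz_cont : ContinuousOn z (Icc 0 T) :=
    (((he.cont z₀).continuousOn).sub (continuousOn_volterra_forward he.cont (hint hKP hZi))).sub
      (continuousOn_volterra_forward he.cont (hint (hconst D.BRB) hRi))
  have hr_cont : ContinuousOn r (Icc 0 T) := by
    refine ContinuousOn.sub (ContinuousOn.sub ?_
      (continuousOn_volterra_backward he.cont_adj (hint hPK hRi)))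
      (continuousOn_volterra_backward he.cont_adj (hint (hconst (D.Qbar ∘L D.S)) hZi))
    exact ((he.cont_adj _).comp (continuous_const.sub continuous_id)).continuousOn
  have hmemLp : ∀ {u : ℝ → H}, ContinuousOn u (Icc 0 T) →
      MemLp u 2 (volume.restrict (Ioc 0 T)) := fun {u} hu => by
    obtain ⟨M, hM⟩ := isCompact_Icc.exists_bound_of_continuousOn hu
    exact MemLp.of_bound ((hu.mono Ioc_subset_Icc_self).aestronglyMeasurable measurableSet_Ioc) M
      (hae hM)
  have hZz : Z =ᵐ[volume.restrict (Ioc 0 T)] z :=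
    hZ.ae_eq (fun n => (hznc _).aestronglyMeasurable) (fun n => hae (hzn _)) (hmemLp hz_cont) (by
      filter_upwards [ae_restrict_mem measurableSet_Ioc] with s hs
      exact hz_lim s ⟨hs.1.le, hs.2⟩)
  have hRr : R =ᵐ[volume.restrict (Ioc 0 T)] r :=
    hR.ae_eq (fun n => (hrnc _).aestronglyMeasurable) (fun n => hae (hrn' _)) (hmemLp hr_cont) (by
      filter_upwards [ae_restrict_mem measurableSet_Ioc] with s hs
      exact hr_lim s ⟨hs.1.le, hs.2⟩)
  have hcongr_forward : ∀ (Φ : ℝ → H →L[ℝ] H) {u v : ℝ → H},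
      u =ᵐ[volume.restrict (Ioc 0 T)] v → ∀ t ∈ Icc 0 T,
      ∫ s in Ioc 0 t, e (t - s) (Φ s (u s)) = ∫ s in (0 : ℝ)..t, D.expA (t - s) (Φ s (v s)) := by
    intro Φ u v huv t ht
    rw [intervalIntegral.integral_of_le ht.1]
    refine integral_congr_ae ?_
    filter_upwards [ae_restrict_mem measurableSet_Ioc,
      ae_restrict_of_ae_restrict_of_subset (Ioc_subset_Ioc_right ht.2) huv] with s hs hs'
    rw [hs', he_eq _ (by linarith [hs.2])]
  have hcongr_backward : ∀ (Φ : ℝ → H →L[ℝ] H) {u v : ℝ → H},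
      u =ᵐ[volume.restrict (Ioc 0 T)] v → ∀ t ∈ Icc 0 T,
      ∫ s in Ioc t T, ContinuousLinearMap.adjoint (e (s - t)) (Φ s (u s))
        = ∫ s in t..T, D.expAdj (s - t) (Φ s (v s)) := by
    intro Φ u v huv t ht
    rw [intervalIntegral.integral_of_le ht.2]
    refine integral_congr_ae ?_
    filter_upwards [ae_restrict_mem measurableSet_Ioc,
      ae_restrict_of_ae_restrict_of_subset (Ioc_subset_Ioc_left ht.1) huv] with s hs hs'
    rw [hs', he_eq _ (by linarith [hs.1]), Coefficients.expAdj]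
  refine ⟨z, r, hz_cont, hr_cont, fun t ht => ?_, fun t ht => ?_⟩
  · have h1 := hcongr_forward (fun s => D.BRB ∘L P s) hZz t ht
    have h2 := hcongr_forward (fun _ => D.BRB) hRr t ht
    calc z t = e t z₀ - (∫ s in Ioc 0 t, e (t - s) ((D.BRB ∘L P s) (Z s)))
          - ∫ s in Ioc 0 t, e (t - s) (D.BRB (R s)) := rfl
      _ = _ := by
        rw [h1, h2, he_eq t ht.1]
        rfl
  · have h1 := hcongr_backward (fun s => P s ∘L D.BRB) hRr t ht
    have h2 := hcongr_backward (fun _ => D.Qbar ∘L D.S) hZz t ht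
    calc r t = ContinuousLinearMap.adjoint (e (T - t)) (-(D.QbarT (D.ST (z T))))
          - (∫ s in Ioc t T, ContinuousLinearMap.adjoint (e (s - t)) ((P s ∘L D.BRB) (R s)))
          - ∫ s in Ioc t T, ContinuousLinearMap.adjoint (e (s - t)) ((D.Qbar ∘L D.S) (Z s)) := rfl
      _ = _ := by
        rw [h1, h2, he_eq (T - t) (by linarith [ht.2])]
        rfl

end ForwardBackward

end LQMFG

/-! ### Assembly of the LQM mild solution -/

theorem theorem3p1 {H K U : Type*}
    [NormedAddCommGroup H] [InnerProductSpace ℝ H] [CompleteSpace H]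
    [TopologicalSpace.SeparableSpace H] [MeasurableSpace H] [BorelSpace H]
    [NormedAddCommGroup K] [InnerProductSpace ℝ K] [CompleteSpace K]
    [TopologicalSpace.SeparableSpace K]
    [NormedAddCommGroup U] [InnerProductSpace ℝ U] [CompleteSpace U]
    [TopologicalSpace.SeparableSpace U]
    (D : LQMFG.Coefficients H K U) (hD : D.Standing)
    (T : ℝ) (hT : 0 < T)
    (m₀ : MeasureTheory.Measure H) [MeasureTheory.IsProbabilityMeasure m₀]
    (hm₀ : MeasureTheory.Integrable (fun x : H => x) m₀)
    (hη : ∀ P : ℝ → H →L[ℝ] H, D.IsMildRiccati T P → D.YosidaRiccatiSolvable T P)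
    (htr : ∀ P : ℝ → H →L[ℝ] H, D.IsMildRiccati T P → D.HasIntegrableTrace T P) :
    ∃ (P : ℝ → H →L[ℝ] H) (r z : ℝ → H) (s : ℝ → ℝ),
      D.IsLQMMildSolution T (∫ x, x ∂m₀) P r z s := by
  obtain ⟨P, hPc, hP⟩ := hD.exists_isMildRiccati hT.le
  obtain ⟨z, r, hzr⟩ := hD.exists_isMildForwardBackward hT.le hPc hP.1.isPositive (hη P hP)
    (∫ x, x ∂m₀)
  have htrace := htr P hP
  -- The scalar component is defined by its own formula, so only its continuity remains: it is a
  -- constant plus the primitive of an integrable function.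
  refine ⟨P, r, z, _, hP, hzr, htrace, ?_, fun t _ => rfl⟩
  have hr := hzr.continuousOn_r
  have hz := hzr.continuousOn_z
  have hint : IntegrableOn (fun u => (1 / 2 : ℝ) * LQMFG.operatorTrace (D.diffusionOp (P u))
      - (1 / 2 : ℝ) * inner ℝ (D.BRB (r u)) (r u)
      + (1 / 2 : ℝ) * inner ℝ (D.Qbar (D.S (z u))) (D.S (z u))) (Icc 0 T) := by
    refine Integrable.add (Integrable.sub (htrace.2.const_mul _) ?_) ?_
    · refine ContinuousOn.integrableOn_Icc (continuousOn_const.mul ?_)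
      exact (D.BRB.continuous.comp_continuousOn hr).inner hr
    · refine ContinuousOn.integrableOn_Icc (continuousOn_const.mul ?_)
      have hSz := D.S.continuous.comp_continuousOn hz
      exact (D.Qbar.continuous.comp_continuousOn hSz).inner hSz
  refine continuousOn_const.add ?_
  have h := intervalIntegral.continuousOn_primitive_interval_left (a := 0) (b := T)
    (by rwa [uIcc_of_le hT.le])
  rwa [uIcc_of_le hT.le] at h
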